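/- Let $p(x) = 1 + a_1 x + a_2 x^2 + \cdots \in \mathbb{R}[[x]]$ be a formal power series with $p(0)=1$, and let $x_1, x_2, \dots$ be countably many variables. Define the formal symmetric series $$\kappa_p := \frac{\prod_{i\ge 1} p(x_i)}{\prod_{1\le i<j}(1-x_i x_j)}.$$ Call a formal power series in $x_1,x_2,\dots$ *Schur-positive* if it is a (possibly infinite) formal linear combination $\sum_\lambda c_\lambda s_\lambda$ of Schur functions with all $c_\lambda \ge 0$ real, and call $p$ *$\kappa$-positive* if $\kappa_p$ is Schur-positive. If $\prod_{i\ge1} p(x_i)$ is Schur-positive, then $p$ is $\kappa$-positive. -/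

import Mathlib

open scoped MvPowerSeries.WithPiTopology

noncomputable section

namespace SchurPos

/-- The content (weight) of a semistandard tableau, as an exponent vector: its value at `k` is the
number of cells with entry `k`. -/
def content {μ : YoungDiagram} (T : SemistandardYoungTableau μ) : ℕ →₀ ℕ :=
  ∑ c ∈ μ.cells, Finsupp.single (T c.1 c.2) 1

/-- The Schur function `s_μ` in the variables `x_0, x_1, x_2, …`: the coefficient of the monomial
`x^d` is the number of semistandard Young tableaux of shape `μ` and content `d`. -/
def schur (μ : YoungDiagram) : MvPowerSeries ℕ ℝ :=
  fun d => (Nat.card {T : SemistandardYoungTableau μ // content T = d} : ℝ)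

/-- `f` is Schur-positive (`s`-positive): it is a possibly infinite formal linear combination of
Schur functions with nonnegative coefficients. The sum converges coefficientwise; in fact at
each monomial only the finitely many diagrams of its degree contribute. -/
def IsSchurPositive (f : MvPowerSeries ℕ ℝ) : Prop :=
  ∃ c : YoungDiagram → ℝ, (∀ μ, 0 ≤ c μ) ∧ HasSum (fun μ => c μ • schur μ) f

/-- The infinite product `∏_i p(x_i)`, converging coefficientwise when `p` has constant
coefficient `1`. -/
def varProd (p : PowerSeries ℝ) : MvPowerSeries ℕ ℝ :=
  ∏' i : ℕ, p.subst (MvPowerSeries.X i : MvPowerSeries ℕ ℝ)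

/-- The infinite product `∏_{i<j} (1 - x_i x_j)`. -/
def pairProd : MvPowerSeries ℕ ℝ :=
  ∏' q : {q : ℕ × ℕ // q.1 < q.2},
    (1 - MvPowerSeries.X q.1.1 * MvPowerSeries.X q.1.2 : MvPowerSeries ℕ ℝ)

/-- `κ_p = ∏_i p(x_i) / ∏_{i<j} (1 - x_i x_j)`. The denominator has constant coefficient `1`, so
it is invertible as a formal power series. -/
def kappa (p : PowerSeries ℝ) : MvPowerSeries ℕ ℝ :=
  varProd p * pairProd⁻¹

/-- `p` is `κ`-positive if `κ_p` is Schur-positive. -/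
def IsKappaPositive (p : PowerSeries ℝ) : Prop :=
  IsSchurPositive (kappa p)

end SchurPos

end

/-!
The factor `∏ p(x_i)` is Schur-positive by hypothesis, so it suffices to show that division by
`∏_{i<j} (1 - x_i x_j)` preserves Schur-positivity (`IsSchurPositive.mul_inv_pairProd`). All
statements are reduced to `n` variables by setting the other variables to zero (`res`).

In `n` variables, a symmetric power series `g` has a unique Schur expansion, and by the bialternant
formula `a_δ s_λ = a_{λ+δ}` the coefficient of `s_λ` is the coefficient of `x^{λ+δ}` in `a_δ g`,
where `a_δ` is the Vandermonde product `vand X` (`IsSymm.hasSum_schur`,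
`coeff_vand_mul_of_hasSum`). In particular it does not depend on `n`, and Schur-positivity means
that `a_δ g` has nonnegative coefficients at all strictly decreasing exponent vectors
(`isSchurPositive_of_coeff_nonneg`). Two positivity results then suffice.

* An alternant times a Schur polynomial is a nonnegative combination of alternants
  (`coeff_alt_mon_mul_columnSum_nonneg`). This is Stembridge's argument for the
  Littlewood–Richardson rule: the tableaux are read column by column from the right, and as soon as
  the partial sums of `λ` and the contents of the columns fail to form a partition, the sum over the
  remaining columns is symmetric in two adjacent variables and disappears under antisymmetrization.
  That symmetry is `columnSum_symm`. It is proved by induction on the number of columns in place of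
  the Bender–Knuth involution. The same argument, started from the empty partition, leaves a single
  term and gives the bialternant formula (`alt_stair_mul_columnSum`).
* The series `G_n = ∏_{a<b} (x_a - x_b) / (1 - x_a x_b)` has nonnegative coefficients at strictly
  decreasing exponent vectors (`coeff_littlewood_nonneg`), so `∏_{a<b} (1 - x_a x_b)⁻¹` is
  Schur-positive in `n` variables. Lagrange interpolation gives
  `G_n (1 - [n even] x_1 ⋯ x_n) = ∑_i G_n|_{x_i = 0}` (`littlewood_mul`). Each summand on the right
  lacks a variable, so subtracting one from all exponents preserves the coefficients of `G_n` if `n`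
  is even, while the coefficients at vectors without zeros vanish if `n` is odd. Together with
  `G_{n+1}|_{x_{n+1} = 0} = x_1 ⋯ x_n G_n` this reduces every coefficient to the case `n = 0`.

Finally, for Schur-positive `g`, the series `a_δ g / ∏_{a<b} (1 - x_a x_b) = G_n g` is a nonnegative
combination of products of alternants with Schur polynomials (`IsAnti.coeff_mul_nonneg`).
-/

noncomputable section

namespace SchurPos

open Finset MvPowerSeries

/-! ### Columns of tableaux and the symmetry of column sums -/

/-- The number of elements of `c` smaller than `m`. -/
def below (c : Finset ℕ) (m : ℕ) : ℕ := #{e ∈ c | e < m}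

/-- A column of a tableau is encoded by the finite set of its entries. `ColLE c' c` says that `c'`
may stand immediately to the left of `c`: the `r`-th smallest entry of `c'` exists and is at most
the `r`-th smallest entry of `c`, for every `r < #c`. -/
def ColLE (c' c : Finset ℕ) : Prop := ∀ m, below c m ≤ below c' m

open Classical in
/-- The generating function of the semistandard fillings, with entries below `n`, of `m` columns
whose lengths are `l 0, …, l (m - 1)` and which can be extended to the right by the column `c`.
The rightmost column is split off first. -/
def columnSum {A : Type*} [CommSemiring A] (y : ℕ → A) (n : ℕ) (l : ℕ → ℕ) : ℕ → Finset ℕ → A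
  | 0, _ => 1
  | m + 1, c => ∑ c' ∈ (range n).powersetCard (l m) with ColLE c' c,
      (∏ i ∈ c', y i) * columnSum y n l m c'

/-- The image of a set of natural numbers under the transposition of `k` and `k + 1`. -/
def swapCol (k : ℕ) (c : Finset ℕ) : Finset ℕ := c.map (Equiv.swap k (k + 1)).toEmbedding

theorem mem_swapCol {k : ℕ} {c : Finset ℕ} {i : ℕ} :
    i ∈ swapCol k c ↔ Equiv.swap k (k + 1) i ∈ c := by
  simp [swapCol, Finset.mem_map_equiv]

theorem left_mem_swapCol {k : ℕ} {c : Finset ℕ} : k ∈ swapCol k c ↔ k + 1 ∈ c := by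
  simp [mem_swapCol]

theorem right_mem_swapCol {k : ℕ} {c : Finset ℕ} : k + 1 ∈ swapCol k c ↔ k ∈ c := by
  simp [mem_swapCol]

theorem swapCol_swapCol (k : ℕ) (c : Finset ℕ) : swapCol k (swapCol k c) = c := by
  ext i
  simp [mem_swapCol]

theorem swapCol_eq_self {k : ℕ} {c : Finset ℕ} (h : k ∈ c ↔ k + 1 ∈ c) : swapCol k c = c := by
  ext i
  rw [mem_swapCol]
  rcases eq_or_ne i k with rfl | h1
  · simp [h]
  rcases eq_or_ne i (k + 1) with rfl | h2
  · simp [h]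
  rw [Equiv.swap_apply_of_ne_of_ne h1 h2]

theorem card_swapCol (k : ℕ) (c : Finset ℕ) : #(swapCol k c) = #c := card_map _

theorem swapCol_subset_range {k n : ℕ} (hk : k + 1 < n) {c : Finset ℕ} (h : c ⊆ range n) :
    swapCol k c ⊆ range n := by
  intro i hi
  rw [mem_swapCol] at hi
  have := mem_range.1 (h hi)
  rw [Equiv.swap_apply_def] at this
  rw [mem_range]
  split_ifs at this <;> omega

theorem below_swapCol {k m : ℕ} (hm : m ≠ k + 1) (c : Finset ℕ) :
    below (swapCol k c) m = below c m := by
  rw [below, swapCol, filter_map, card_map, below]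
  congr 1
  refine filter_congr fun i _ => ?_
  simp only [Function.comp, Equiv.coe_toEmbedding, Equiv.swap_apply_def]
  split_ifs <;> omega

open Classical in
theorem below_succ (c : Finset ℕ) (k : ℕ) :
    below c (k + 1) = below c k + if k ∈ c then 1 else 0 := by
  simp only [below]
  split_ifs with h
  · have : {e ∈ c | e < k + 1} = insert k {e ∈ c | e < k} := by
      ext i
      simp only [mem_filter, mem_insert]
      constructor
      · rintro ⟨h1, h2⟩
        by_cases hi : i = k
        · exact Or.inl hi
        · exact Or.inr ⟨h1, by omega⟩
      · rintro (rfl | ⟨h1, h2⟩)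
        · exact ⟨h, by omega⟩
        · exact ⟨h1, by omega⟩
    rw [this, card_insert_of_notMem (by simp)]
  · congr 1
    refine filter_congr fun i hi => ?_
    have : i ≠ k := fun h' => h (h' ▸ hi)
    omega

/-- Unless `c` contains `k` but not `k + 1`, the columns that fit to the left of `c` are permuted by
the transposition of `k` and `k + 1`. -/
theorem ColLE.swapCol {k : ℕ} {c c' : Finset ℕ} (hc : ¬(k ∈ c ∧ k + 1 ∉ c)) (h : ColLE c' c) :
    ColLE (swapCol k c') c := by
  classical
  intro m
  by_cases hm : m = k + 1
  · -- Only the number of entries below `k + 1` is affected by the transposition.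
    subst hm
    have h0 := h k
    have h2 := h (k + 2)
    have h1 := h (k + 1)
    rw [below_succ _ (k + 1), below_succ _ (k + 1)] at h2
    simp only [below_succ _ k, left_mem_swapCol, below_swapCol (Nat.succ_ne_self k).symm]
      at h1 h2 ⊢
    split_ifs at * <;> first | omega | tauto
  · rw [below_swapCol hm]
    exact h m

theorem ColLE.of_swapCol {k : ℕ} {c c' : Finset ℕ} (hc : k ∉ c)
    (h : ColLE c' (SchurPos.swapCol k c)) : ColLE c' c := by
  classical
  intro m
  by_cases hm : m = k + 1
  · subst hm
    have h0 := h (k + 1)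
    simp only [below_succ _ k, left_mem_swapCol, below_swapCol (Nat.succ_ne_self k).symm] at h0 ⊢
    rw [if_neg hc]
    omega
  · rw [← below_swapCol hm c]
    exact h m

/-- Replacing the entry `k + 1` of `c` by `k` excludes only columns containing `k + 1` but not `k`
on the left. -/
theorem ColLE.mem_of_not_swapCol {k : ℕ} {c c' : Finset ℕ} (hc : k ∉ c) (hc' : k + 1 ∈ c)
    (h : ColLE c' c) (h' : ¬ ColLE c' (SchurPos.swapCol k c)) : k ∉ c' ∧ k + 1 ∈ c' := by
  classical
  have key : ¬ below (SchurPos.swapCol k c) (k + 1) ≤ below c' (k + 1) := by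
    intro h1
    refine h' fun m => ?_
    by_cases hm : m = k + 1
    · exact hm ▸ h1
    · exact (below_swapCol hm c).trans_le (h m)
  have h0 := h k
  have h2 := h (k + 2)
  rw [below_succ _ (k + 1), below_succ _ (k + 1)] at h2
  simp only [below_succ _ k, left_mem_swapCol, below_swapCol (Nat.succ_ne_self k).symm]
      at key h2
  split_ifs at * <;> first | omega | tauto

section Symmetry

variable {A : Type*} [CommRing A] {y : ℕ → A} {σ : A →+* A} {k : ℕ}

theorem map_colProd (hσ : ∀ i, σ (y i) = y (Equiv.swap k (k + 1) i)) (c : Finset ℕ) :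
    σ (∏ i ∈ c, y i) = ∏ i ∈ swapCol k c, y i := by
  rw [map_prod, swapCol, prod_map]
  exact prod_congr rfl fun i _ => hσ i

theorem map_colProd_erase (hσ : ∀ i, σ (y i) = y (Equiv.swap k (k + 1) i)) {c : Finset ℕ}
    (hk : k ∉ c) : σ (∏ i ∈ c.erase (k + 1), y i) = ∏ i ∈ c.erase (k + 1), y i := by
  rw [map_colProd hσ, swapCol_eq_self]
  simp [hk]

theorem colProd_eq {c : Finset ℕ} (hk' : k + 1 ∈ c) :
    ∏ i ∈ c, y i = y (k + 1) * ∏ i ∈ c.erase (k + 1), y i :=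
  (mul_prod_erase c y hk').symm

theorem colProd_swapCol_eq {c : Finset ℕ} (hk : k ∉ c) (hk' : k + 1 ∈ c) :
    ∏ i ∈ swapCol k c, y i = y k * ∏ i ∈ c.erase (k + 1), y i := by
  have : swapCol k c = insert k (c.erase (k + 1)) := by
    ext i
    rw [mem_swapCol, mem_insert, mem_erase, Equiv.swap_apply_def]
    split_ifs with h1 h2
    · simp [h1, hk']
    · simp [h2, hk]
    · simp [h1, h2]
  rw [this, prod_insert (by simp [hk])]

/-- The generating function of the columns to the left of `c` is symmetric in `y k` and
`y (k + 1)` unless `c` contains `k` but not `k + 1`; in that exceptional case, the column sums for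
`c` and for `swapCol k c`, weighted by the entry in which the two columns differ, have a symmetric
sum. The two statements are proved by a common induction, which replaces the Bender–Knuth
involution. -/
theorem columnSum_symm_aux [IsAddTorsionFree A]
    (hσ : ∀ i, σ (y i) = y (Equiv.swap k (k + 1) i)) {n : ℕ} (hn : k + 1 < n) (l : ℕ → ℕ) (m : ℕ) :
    (∀ c : Finset ℕ, ¬(k ∈ c ∧ k + 1 ∉ c) → σ (columnSum y n l m c) = columnSum y n l m c) ∧
    (∀ c : Finset ℕ, k ∉ c → k + 1 ∈ c →
      σ (y (k + 1) * columnSum y n l m c + y k * columnSum y n l m (swapCol k c)) =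
        y (k + 1) * columnSum y n l m c + y k * columnSum y n l m (swapCol k c)) := by
  classical
  have hσ0 : σ (y k) = y (k + 1) := by rw [hσ, Equiv.swap_apply_left]
  have hσ1 : σ (y (k + 1)) = y k := by rw [hσ, Equiv.swap_apply_right]
  induction m with
  | zero =>
    refine ⟨fun c _ => by simp [columnSum], fun c _ _ => ?_⟩
    simp only [columnSum, mul_one, map_add, hσ0, hσ1]
    ring
  | succ m ih =>
    obtain ⟨ihP, ihQ⟩ := ih
    -- A column together with its image under the transposition contributes symmetrically.
    have pair : ∀ c : Finset ℕ, k ∉ c → k + 1 ∈ c →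
        σ ((∏ i ∈ c, y i) * columnSum y n l m c +
          (∏ i ∈ swapCol k c, y i) * columnSum y n l m (swapCol k c)) =
        (∏ i ∈ c, y i) * columnSum y n l m c +
          (∏ i ∈ swapCol k c, y i) * columnSum y n l m (swapCol k c) := by
      intro c h1 h2
      have : (∏ i ∈ c, y i) * columnSum y n l m c +
          (∏ i ∈ swapCol k c, y i) * columnSum y n l m (swapCol k c) =
          (∏ i ∈ c.erase (k + 1), y i) *
            (y (k + 1) * columnSum y n l m c + y k * columnSum y n l m (swapCol k c)) := by
        rw [colProd_eq h2, colProd_swapCol_eq h1 h2]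
        ring
      rw [this, map_mul, ihQ c h1 h2, map_colProd_erase hσ h1]
    have hP : ∀ c : Finset ℕ, ¬(k ∈ c ∧ k + 1 ∉ c) →
        σ (columnSum y n l (m + 1) c) = columnSum y n l (m + 1) c := by
      intro c hc
      -- Doubling the sum allows each column to be paired with its image under the transposition.
      have hsum : 2 • columnSum y n l (m + 1) c =
          ∑ c' ∈ (range n).powersetCard (l m) with ColLE c' c,
            ((∏ i ∈ c', y i) * columnSum y n l m c' +
              (∏ i ∈ swapCol k c', y i) * columnSum y n l m (swapCol k c')) := by
        rw [sum_add_distrib, two_nsmul, columnSum]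
        congr 1
        have hmem : ∀ c' ∈ {c' ∈ (range n).powersetCard (l m) | ColLE c' c},
            swapCol k c' ∈ {c' ∈ (range n).powersetCard (l m) | ColLE c' c} := by
          intro c' h'
          simp only [mem_filter, mem_powersetCard] at h' ⊢
          exact ⟨⟨swapCol_subset_range hn h'.1.1, by rw [card_swapCol, h'.1.2]⟩,
            h'.2.swapCol hc⟩
        exact sum_nbij' (swapCol k) (swapCol k) hmem hmem
          (fun _ _ => swapCol_swapCol _ _) (fun _ _ => swapCol_swapCol _ _)
          (fun _ _ => by rw [swapCol_swapCol])
      have : 2 • σ (columnSum y n l (m + 1) c) = 2 • columnSum y n l (m + 1) c := by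
        rw [← map_nsmul, hsum, map_sum]
        refine sum_congr rfl fun c' _ => ?_
        by_cases h1 : k ∈ c' <;> by_cases h2 : k + 1 ∈ c'
        · rw [swapCol_eq_self (by simp [h1, h2]), map_add, map_mul, map_colProd hσ,
            swapCol_eq_self (by simp [h1, h2]), ihP c' (by simp [h2])]
        · have := pair (swapCol k c') (by rwa [left_mem_swapCol]) (by rwa [right_mem_swapCol])
          rwa [swapCol_swapCol, add_comm] at this
        · exact pair c' h1 h2
        · rw [swapCol_eq_self (by simp [h1, h2]), map_add, map_mul, map_colProd hσ,
            swapCol_eq_self (by simp [h1, h2]), ihP c' (by simp [h1])]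
      exact nsmul_right_injective two_ne_zero this
    refine ⟨hP, fun c h1 h2 => ?_⟩
    -- The columns that fit to the left of `c` but not of `swapCol k c` contain `k + 1`, not `k`.
    have hD : columnSum y n l (m + 1) c = columnSum y n l (m + 1) (swapCol k c) +
        ∑ c' ∈ (range n).powersetCard (l m) with ColLE c' c ∧ ¬ ColLE c' (swapCol k c),
          (∏ i ∈ c', y i) * columnSum y n l m c' := by
      rw [columnSum, columnSum, ← sum_union]
      · congr 1
        ext c'
        have := ColLE.of_swapCol (c' := c') h1
        simp only [mem_union, mem_filter]
        tauto
      · rw [disjoint_filter]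
        tauto
    -- Each excluded column contributes the symmetric factor `y k * y (k + 1)` after the weighting.
    have hE : y (k + 1) * columnSum y n l (m + 1) c + y k * columnSum y n l (m + 1) (swapCol k c) =
        (y k + y (k + 1)) * columnSum y n l (m + 1) c -
        ∑ c' ∈ (range n).powersetCard (l m) with ColLE c' c ∧ ¬ ColLE c' (swapCol k c),
          y k * y (k + 1) * ((∏ i ∈ c'.erase (k + 1), y i) * columnSum y n l m c') := by
      have : ∑ c' ∈ (range n).powersetCard (l m) with ColLE c' c ∧ ¬ ColLE c' (swapCol k c),
          y k * y (k + 1) * ((∏ i ∈ c'.erase (k + 1), y i) * columnSum y n l m c') =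
          y k * ∑ c' ∈ (range n).powersetCard (l m) with ColLE c' c ∧ ¬ ColLE c' (swapCol k c),
            (∏ i ∈ c', y i) * columnSum y n l m c' := by
        rw [mul_sum]
        refine sum_congr rfl fun c' h' => ?_
        simp only [mem_filter] at h'
        rw [colProd_eq (h'.2.1.mem_of_not_swapCol h1 h2 h'.2.2).2]
        ring
      rw [this, hD]
      ring
    rw [hE, map_sub, map_mul, map_add, hσ0, hσ1, hP c (by simp [h1]), map_sum, add_comm (y (k + 1))]
    congr 1
    refine sum_congr rfl fun c' h' => ?_
    simp only [mem_filter] at h'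
    obtain ⟨h3, h4⟩ := h'.2.1.mem_of_not_swapCol h1 h2 h'.2.2
    rw [map_mul, map_mul, map_mul, hσ0, hσ1, map_colProd_erase hσ h3, ihP c' (by simp [h3]),
      mul_comm (y (k + 1))]

theorem columnSum_symm [IsAddTorsionFree A]
    (hσ : ∀ i, σ (y i) = y (Equiv.swap k (k + 1) i)) {n : ℕ} (hn : k + 1 < n) (l : ℕ → ℕ) (m : ℕ)
    {c : Finset ℕ} (hc : ¬(k ∈ c ∧ k + 1 ∉ c)) :
    σ (columnSum y n l m c) = columnSum y n l m c :=
  (columnSum_symm_aux hσ hn l m).1 c hc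

end Symmetry

variable {n : ℕ}

/-! ### Alternants and their products with Schur polynomials -/

instance : IsAddTorsionFree (MvPowerSeries (Fin n) ℝ) where
  nsmul_right_injective k hk f g h := by
    ext d
    have := congrArg (coeff d) h
    simp only [map_nsmul] at this
    exact nsmul_right_injective hk this

/-- The exponent vector with the given entries. -/
abbrev expo (α : Fin n → ℕ) : Fin n →₀ ℕ := Finsupp.equivFunOnFinite.symm α

/-- The monomial `x^α`. -/
def mon (α : Fin n → ℕ) : MvPowerSeries (Fin n) ℝ := monomial (expo α) 1

/-- The variables of `MvPowerSeries (Fin n) ℝ`, indexed by all natural numbers and with value `0`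
beyond `n`. -/
def var (n : ℕ) (i : ℕ) : MvPowerSeries (Fin n) ℝ := if h : i < n then X ⟨i, h⟩ else 0

theorem expo_add (α β : Fin n → ℕ) : expo (α + β) = expo α + expo β := by
  ext; simp

theorem mon_add (α β : Fin n → ℕ) : mon (α + β) = mon α * mon β := by
  rw [mon, expo_add, mon, mon, monomial_mul_monomial, one_mul]

theorem coeff_mon (α β : Fin n → ℕ) : coeff (expo β) (mon α) = if β = α then 1 else 0 := by
  classical
  simp [mon, coeff_monomial]

theorem coeff_rename_perm (w : Equiv.Perm (Fin n)) (β : Fin n → ℕ) (f : MvPowerSeries (Fin n) ℝ) :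
    coeff (expo β) (rename w f) = coeff (expo (β ∘ w)) f := by
  have h := coeff_embDomain_rename w.toEmbedding f (expo (β ∘ w))
  have h2 : Finsupp.embDomain w.toEmbedding (expo (β ∘ w)) = expo β := by
    ext i
    obtain ⟨j, rfl⟩ := w.surjective i
    simpa using! Finsupp.embDomain_apply_self w.toEmbedding (expo (β ∘ w)) j
  rw [h2] at h
  exact h

theorem rename_mon (w : Equiv.Perm (Fin n)) (α : Fin n → ℕ) :
    rename w (mon (α ∘ w)) = mon α := by
  ext d
  obtain ⟨β, rfl⟩ := Finsupp.equivFunOnFinite.symm.surjective d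
  change coeff (expo β) _ = coeff (expo β) _
  rw [coeff_rename_perm, coeff_mon, coeff_mon]
  exact if_congr ⟨fun h => w.surjective.injective_comp_right h, fun h => h ▸ rfl⟩ rfl rfl

theorem colProd_var {c : Finset ℕ} (hc : c ⊆ range n) :
    ∏ i ∈ c, var n i = mon (fun i : Fin n => if (i : ℕ) ∈ c then 1 else 0) := by
  induction c using Finset.induction_on with
  | empty =>
    simp only [prod_empty, notMem_empty, if_false]
    change 1 = monomial _ _
    have : expo (fun _ : Fin n => 0) = 0 := by ext; simp
    rw [this]
    rfl
  | insert a s ha ih =>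
    have han : a < n := mem_range.1 (hc (mem_insert_self a s))
    rw [prod_insert ha, ih ((subset_insert a s).trans hc), var, dif_pos han]
    have : (X ⟨a, han⟩ : MvPowerSeries (Fin n) ℝ) = mon (Pi.single ⟨a, han⟩ 1) := by
      rw [mon, X]
      congr 1
      ext i
      simp
    rw [this, ← mon_add]
    congr 1
    ext i
    simp only [Pi.add_apply, Pi.single_apply, mem_insert, Fin.ext_iff]
    by_cases h : (i : ℕ) = a
    · simp [h, ha]
    · simp [h]

theorem rename_swap_var {k : ℕ} (hk : k + 1 < n) (i : ℕ) :
    rename (Equiv.swap (⟨k, by omega⟩ : Fin n) ⟨k + 1, hk⟩) (var n i) =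
      var n (Equiv.swap k (k + 1) i) := by
  by_cases hi : i < n
  · have hi' : Equiv.swap k (k + 1) i < n := by
      rw [Equiv.swap_apply_def]; split_ifs <;> omega
    rw [var, dif_pos hi, var, dif_pos hi', rename_X]
    congr 1
    simp only [Equiv.swap_apply_def, Fin.ext_iff]
    split_ifs <;> rfl
  · rw [Equiv.swap_apply_of_ne_of_ne (by omega) (by omega), var, dif_neg hi, map_zero]

/-- A power series in finitely many variables is symmetric if it is fixed by all permutations of
the variables. -/
def IsSymm (f : MvPowerSeries (Fin n) ℝ) : Prop := ∀ w : Equiv.Perm (Fin n), rename w f = f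

/-- It suffices to check symmetry on the transpositions of adjacent variables. -/
theorem isSymm_of_swap {f : MvPowerSeries (Fin n) ℝ}
    (h : ∀ (k : ℕ) (hk : k + 1 < n),
      rename (Equiv.swap (⟨k, by omega⟩ : Fin n) ⟨k + 1, hk⟩) f = f) : IsSymm f := by
  intro w
  rcases n with _ | n
  · rw [Subsingleton.elim w 1]
    simp
  have hw : w ∈ Submonoid.closure
      (Set.range fun i : Fin n => Equiv.swap i.castSucc i.succ) := by
    rw [Equiv.Perm.mclosure_swap_castSucc_succ]; trivial
  induction hw using Submonoid.closure_induction with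
  | mem x hx =>
    obtain ⟨i, rfl⟩ := hx
    exact h i (by omega)
  | one => simp
  | mul x y _ _ hx hy =>
    have := rename_rename (R := ℝ) y x f
    rw [hy, hx] at this
    exact this.symm

theorem columnSum_isSymm (l : ℕ → ℕ) (m : ℕ) : IsSymm (columnSum (var n) n l m ∅) :=
  isSymm_of_swap fun _ hk => columnSum_symm
    (σ := (rename (Equiv.swap _ _) : _ →ₐ[ℝ] MvPowerSeries (Fin n) ℝ).toRingHom)
    (rename_swap_var hk) hk l m (by simp)

theorem sign_mul_sign (w : Equiv.Perm (Fin n)) :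
    ((Equiv.Perm.sign w : ℤ) : ℝ) * ((Equiv.Perm.sign w : ℤ) : ℝ) = 1 := by
  rw [← Int.cast_mul, ← Units.val_mul, Int.units_mul_self]
  simp

/-- The antisymmetrization `∑_w sgn(w) w(f)`. -/
def alt (f : MvPowerSeries (Fin n) ℝ) : MvPowerSeries (Fin n) ℝ :=
  ∑ w : Equiv.Perm (Fin n), ((Equiv.Perm.sign w : ℤ) : ℝ) • rename w f

theorem alt_sum {ι : Type*} (s : Finset ι) (f : ι → MvPowerSeries (Fin n) ℝ) :
    alt (∑ i ∈ s, f i) = ∑ i ∈ s, alt (f i) := by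
  simp only [alt, map_sum, smul_sum]
  exact sum_comm

theorem alt_smul (a : ℝ) (f : MvPowerSeries (Fin n) ℝ) : alt (a • f) = a • alt f := by
  simp only [alt, map_smul, smul_sum]
  exact sum_congr rfl fun w _ => smul_comm _ _ _

theorem alt_mul_of_isSymm (f : MvPowerSeries (Fin n) ℝ) {g : MvPowerSeries (Fin n) ℝ}
    (hg : IsSymm g) : alt (f * g) = alt f * g := by
  simp only [alt, map_mul, hg _, sum_mul, smul_mul_assoc]

theorem alt_rename (w : Equiv.Perm (Fin n)) (f : MvPowerSeries (Fin n) ℝ) :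
    alt (rename w f) = ((Equiv.Perm.sign w : ℤ) : ℝ) • alt f := by
  simp only [alt, smul_sum]
  refine Fintype.sum_equiv (Equiv.mulRight w) _ _ fun v => ?_
  rw [rename_rename, smul_smul, Equiv.coe_mulRight, Equiv.Perm.sign_mul]
  congr 1
  push_cast
  rw [mul_comm, mul_assoc, sign_mul_sign, mul_one]

theorem rename_alt (w : Equiv.Perm (Fin n)) (f : MvPowerSeries (Fin n) ℝ) :
    rename w (alt f) = ((Equiv.Perm.sign w : ℤ) : ℝ) • alt f := by
  simp only [alt, smul_sum, map_sum, map_smul]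
  refine Fintype.sum_equiv (Equiv.mulLeft w) _ _ fun v => ?_
  rw [rename_rename, smul_smul, Equiv.coe_mulLeft, Equiv.Perm.sign_mul]
  congr 1
  push_cast
  rw [← mul_assoc, sign_mul_sign, one_mul]

theorem alt_eq_zero_of_swap {i j : Fin n} (hij : i ≠ j) {f : MvPowerSeries (Fin n) ℝ}
    (hf : rename (Equiv.swap i j) f = f) : alt f = 0 := by
  have h := alt_rename (Equiv.swap i j) f
  rw [hf, Equiv.Perm.sign_swap hij] at h
  simp only [Units.val_neg, Units.val_one, Int.cast_neg, Int.cast_one, neg_smul, one_smul] at h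
  exact self_eq_neg.1 h

theorem coeff_alt (β : Fin n → ℕ) (f : MvPowerSeries (Fin n) ℝ) :
    coeff (expo β) (alt f) =
      ∑ w : Equiv.Perm (Fin n), ((Equiv.Perm.sign w : ℤ) : ℝ) * coeff (expo (β ∘ w)) f := by
  simp only [alt, map_sum, map_smul, smul_eq_mul, coeff_rename_perm]

theorem eq_one_of_strictAnti_comp {α : Fin n → ℕ} {w : Equiv.Perm (Fin n)} (hα : StrictAnti α)
    (hw : StrictAnti (α ∘ w)) : w = 1 := by
  have : StrictMono w := fun i j hij => hα.lt_iff_gt.1 (hw hij)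
  have h := Subsingleton.elim (this.orderIsoOfSurjective w w.surjective) (OrderIso.refl _)
  ext i
  exact congrArg Fin.val (DFunLike.congr_fun h i)

theorem coeff_alt_mon {α β : Fin n → ℕ} (hα : StrictAnti α) (hβ : StrictAnti β) :
    coeff (expo β) (alt (mon α)) = if β = α then 1 else 0 := by
  rw [coeff_alt, sum_eq_single 1]
  · simp [coeff_mon]
  · intro w _ hw
    rw [coeff_mon, if_neg, mul_zero]
    rintro rfl
    exact hw (eq_one_of_strictAnti_comp hβ hα)
  · simp

/-- The staircase `(n - 1, …, 1, 0)`. -/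
def stair (n : ℕ) : Fin n → ℕ := fun i => n - 1 - i

theorem stair_strictAnti : StrictAnti (stair n) := by
  intro i j hij
  have : (i : ℕ) < j := hij
  simp only [stair]
  omega

theorem add_stair_strictAnti {α : Fin n → ℕ} (hα : Antitone α) : StrictAnti (α + stair n) :=
  fun _ _ hij => add_lt_add_of_le_of_lt (hα hij.le) (stair_strictAnti hij)

theorem antitone_of_succ {α : Fin n → ℕ}
    (h : ∀ (k : ℕ) (hk : k + 1 < n), α ⟨k + 1, hk⟩ ≤ α ⟨k, by omega⟩) : Antitone α := by
  rcases n with _ | n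
  · exact fun i => i.elim0
  · exact Fin.antitone_iff_succ_le.2 fun i => h i (by omega)

/-- The exponent vector of the monomial attached to a column. -/
def colInd (n : ℕ) (c : Finset ℕ) : Fin n → ℕ := fun i => if (i : ℕ) ∈ c then 1 else 0

/-- Adding a column which destroys the partition property gives a summand that vanishes under
antisymmetrization, because it is invariant under an adjacent transposition. -/
theorem alt_column_eq_zero (l : ℕ → ℕ) (m : ℕ) {α : Fin n → ℕ} (hα : Antitone α) {c : Finset ℕ}
    (h : ¬ Antitone (α + colInd n c)) :
    alt (mon (α + colInd n c + stair n) * columnSum (var n) n l m c) = 0 := by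
  obtain ⟨k, hk, hlt⟩ : ∃ (k : ℕ) (hk : k + 1 < n),
      (α + colInd n c) ⟨k, by omega⟩ < (α + colInd n c) ⟨k + 1, hk⟩ := by
    by_contra! hcon
    exact h (antitone_of_succ hcon)
  have hle : α ⟨k + 1, hk⟩ ≤ α ⟨k, by omega⟩ := hα (by simp [Fin.le_def])
  simp only [Pi.add_apply, colInd] at hlt
  have hkc : k ∉ c := fun hkc => by simp only [if_pos hkc] at hlt; split_ifs at hlt <;> omega
  have hkc' : k + 1 ∈ c := by
    by_contra hkc'
    simp only [if_neg hkc', if_neg hkc] at hlt; omega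
  simp only [if_pos hkc', if_neg hkc] at hlt
  have hne : (⟨k, by omega⟩ : Fin n) ≠ ⟨k + 1, hk⟩ := by simp [Fin.ext_iff]
  refine alt_eq_zero_of_swap hne ?_
  rw [map_mul]
  congr 1
  · have hinv : (α + colInd n c + stair n) ∘ Equiv.swap (⟨k, by omega⟩ : Fin n) ⟨k + 1, hk⟩ =
        α + colInd n c + stair n := by
      have h1 : (α + colInd n c + stair n) ⟨k, by omega⟩ =
          (α + colInd n c + stair n) ⟨k + 1, hk⟩ := by
        simp only [Pi.add_apply, colInd, stair, if_pos hkc', if_neg hkc]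
        omega
      ext i
      simp only [Function.comp, Equiv.swap_apply_def]
      split_ifs with h2 h3
      · rw [h2, h1]
      · rw [h3, h1]
      · rfl
    conv_lhs => rw [← hinv]
    rw [rename_mon]
  · exact columnSum_symm
      (σ := (rename (Equiv.swap _ _) : _ →ₐ[ℝ] MvPowerSeries (Fin n) ℝ).toRingHom)
      (rename_swap_var hk) hk l m (by simp [hkc])

theorem alt_mon_mul_columnSum_succ (l : ℕ → ℕ) (m : ℕ) (α : Fin n → ℕ) (c : Finset ℕ)
    [DecidablePred fun c' => ColLE c' c] :
    alt (mon (α + stair n) * columnSum (var n) n l (m + 1) c) =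
      ∑ c' ∈ (range n).powersetCard (l m) with ColLE c' c,
        alt (mon (α + colInd n c' + stair n) * columnSum (var n) n l m c') := by
  rw [columnSum, mul_sum, alt_sum]
  refine sum_congr (by ext; simp) fun c' hc' => ?_
  simp only [mem_filter, mem_powersetCard] at hc'
  rw [colProd_var hc'.1.1, ← mul_assoc, ← mon_add]
  congr 3
  change α + stair n + colInd n c' = α + colInd n c' + stair n
  abel

/-- The product of an alternant and a Schur polynomial is a nonnegative combination of alternants.
The columns are added one at a time from the right; those which destroy the partition property
cancel, and the others leave an alternant multiplied by a shorter column sum. This is the positivity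
of the Littlewood–Richardson coefficients. -/
theorem coeff_alt_mon_mul_columnSum_nonneg (l : ℕ → ℕ) {β : Fin n → ℕ} (hβ : StrictAnti β) (m : ℕ) :
    ∀ {α : Fin n → ℕ} (_ : Antitone α) (c : Finset ℕ),
      0 ≤ coeff (expo β) (alt (mon (α + stair n) * columnSum (var n) n l m c)) := by
  classical
  induction m with
  | zero =>
    intro α hα c
    rw [columnSum, mul_one, coeff_alt_mon (add_stair_strictAnti hα) hβ]
    split_ifs <;> norm_num
  | succ m ih =>
    intro α hα c
    rw [alt_mon_mul_columnSum_succ, map_sum]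
    refine sum_nonneg fun c' _ => ?_
    by_cases h : Antitone (α + colInd n c')
    · exact ih h c'
    · rw [alt_column_eq_zero l m hα h, map_zero]

theorem below_range {a m : ℕ} : below (range a) m = min a m := by
  rw [below]
  have : {e ∈ range a | e < m} = range (min a m) := by
    ext i; simp
  rw [this, card_range]

theorem subset_of_colLE_range {a : ℕ} {c : Finset ℕ} (h : ColLE c (range a)) : range a ⊆ c := by
  have h1 := h a
  rw [below_range, min_self, below] at h1
  have h2 : {e ∈ c | e < a} ⊆ range a := fun i hi => by
    simpa using (mem_filter.1 hi).2
  rw [← eq_of_subset_of_card_le h2 (by simpa using h1)]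
  exact filter_subset _ _

theorem colLE_range {a b : ℕ} (h : a ≤ b) : ColLE (range b) (range a) := by
  intro m
  rw [below_range, below_range]
  exact min_le_min_right m h

/-- When the columns added so far are initial segments, the only way of adding a column without
destroying the partition property is to add an initial segment. -/
theorem eq_range_of_antitone {a : ℕ} {α : Fin n → ℕ} (hα : ∀ i : Fin n, a ≤ i → α i = 0)
    {c : Finset ℕ} (hcn : c ⊆ range n) (hc : ColLE c (range a))
    (h : Antitone (α + colInd n c)) : c = range #c := by
  have hdown : ∀ i ∈ c, ∀ j, j < i → j ∈ c := by
    intro i hi j hj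
    by_cases hja : j < a
    · exact subset_of_colLE_range hc (mem_range.2 hja)
    have hin := mem_range.1 (hcn hi)
    have := @h ⟨j, by omega⟩ ⟨i, hin⟩ (by simp [Fin.le_def, hj.le])
    simp only [Pi.add_apply, colInd, hα ⟨j, by omega⟩ (by simpa using hja),
      hα ⟨i, hin⟩ (by simp; omega), if_pos hi] at this
    by_contra hjc
    simp [hjc] at this
  have hsub : c ⊆ range #c := by
    intro i hi
    have : range (i + 1) ⊆ c := by
      intro j hj
      rcases Nat.lt_succ_iff_lt_or_eq.1 (mem_range.1 hj) with h1 | rfl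
      · exact hdown i hi j h1
      · exact hi
    have := card_le_card this
    rw [card_range] at this
    exact mem_range.2 this
  exact eq_of_subset_of_card_le hsub (by simp)

/-- When `a` is the length of the column added last, and all columns added so far are initial
segments, exactly one way of adding the remaining `m` columns survives antisymmetrization: all of
them are initial segments. -/
theorem alt_mon_mul_columnSum_range {l : ℕ → ℕ} (hl : Antitone l) (m : ℕ) :
    ∀ {a : ℕ} {α : Fin n → ℕ} (_ : Antitone α) (_ : ∀ i : Fin n, a ≤ i → α i = 0)
      (_ : ∀ j < m, a ≤ l j) (_ : ∀ j < m, l j ≤ n),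
      alt (mon (α + stair n) * columnSum (var n) n l m (range a)) =
        alt (mon (α + (fun i : Fin n => #{j ∈ range m | (i : ℕ) < l j}) + stair n)) := by
  classical
  induction m with
  | zero =>
    intro a α _ _ _ _
    rw [columnSum, mul_one]
    congr 3
  | succ m ih =>
    intro a α hα hα0 ha hn
    have hind : α + colInd n (range (l m)) +
        (fun i : Fin n => #{j ∈ range m | (i : ℕ) < l j}) =
        α + fun i : Fin n => #{j ∈ range (m + 1) | (i : ℕ) < l j} := by
      ext i
      simp only [Pi.add_apply, colInd, mem_range, range_add_one, filter_insert]
      split_ifs with h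
      · rw [card_insert_of_notMem (by simp)]; ring
      · ring
    have hanti : Antitone (α + colInd n (range (l m))) := by
      refine hα.add fun i j hij => ?_
      have : (i : ℕ) ≤ j := hij
      simp only [colInd, mem_range]
      split_ifs <;> omega
    rw [alt_mon_mul_columnSum_succ, sum_eq_single (range (l m))]
    · rw [ih hanti ?_ (fun j hj => hl hj.le) (fun j hj => hn j (by omega)), hind]
      intro i hi
      have := hα0 i ((ha m (by omega)).trans hi)
      simp only [Pi.add_apply, this, colInd, mem_range]
      rw [if_neg (by omega)]
    · intro c hc hne
      simp only [mem_filter, mem_powersetCard] at hc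
      refine alt_column_eq_zero l m hα fun h => hne ?_
      rw [← hc.1.2]
      exact eq_range_of_antitone hα0 hc.1.1 hc.2 h
    · intro h
      refine absurd ?_ h
      simp only [mem_filter, mem_powersetCard]
      exact ⟨⟨range_subset_range.2 (hn m (by omega)), card_range _⟩,
        colLE_range (ha m (by omega))⟩

/-- The bialternant formula for Schur polynomials. -/
theorem alt_stair_mul_columnSum {l : ℕ → ℕ} (hl : Antitone l) {m : ℕ} (hn : ∀ j < m, l j ≤ n) :
    alt (mon (stair n)) * columnSum (var n) n l m ∅ =
      alt (mon ((fun i : Fin n => #{j ∈ range m | (i : ℕ) < l j}) + stair n)) := by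
  rw [← alt_mul_of_isSymm _ (columnSum_isSymm l m)]
  have := alt_mon_mul_columnSum_range (n := n) hl m (a := 0) (α := 0) (fun _ _ _ => le_rfl)
    (fun _ _ => rfl) (fun _ _ => Nat.zero_le _) hn
  simpa using this

/-! ### The Littlewood identity -/

/-- The partial fraction identity behind the Littlewood identity, obtained by interpolating
`∏ j, (1 - z * x j)`, a polynomial in `z` of degree at most `n`, in the `n + 3` nodes `0`, `1`,
`-1` and `x i`. -/
theorem sum_prod_div_eq {K : Type*} [Field K] [CharZero K] {x : Fin n → K}
    (hx : Function.Injective x) (h0 : ∀ i, x i ≠ 0) (h1 : ∀ i, x i ≠ 1) (h2 : ∀ i, x i ≠ -1) :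
    ∑ i, ∏ j ∈ univ.erase i, (x j * (1 - x i * x j) / (x j - x i)) =
      1 - if Even n then ∏ j, x j else 0 := by
  classical
  set P : Polynomial K := ∏ j, (1 - Polynomial.C (x j) * Polynomial.X) with hP
  have hPeval : ∀ z, P.eval z = ∏ j, (1 - x j * z) := fun z => by
    simp [hP, Polynomial.eval_prod]
  have hdeg : P.natDegree ≤ n := by
    refine (Polynomial.natDegree_prod_le _ _).trans ?_
    refine (sum_le_sum (g := fun _ => 1) fun j _ => ?_).trans (by simp)
    compute_degree
  set I : Finset K := univ.image x with hI
  have hI0 : (0 : K) ∉ I := by simp [hI, h0]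
  have hI1 : (1 : K) ∉ I := by simp [hI, h1]
  have hI2 : (-1 : K) ∉ I := by simp [hI, h2]
  have h3 : (-1 : K) ≠ 1 := by
    intro h
    have : (2 : K) = 0 := by linear_combination -h
    exact two_ne_zero this
  have hcardI : #I = n := by rw [hI, card_image_of_injective _ hx]; simp
  have hm : (-1 : K) ∉ I := hI2
  have hm1 : (1 : K) ∉ insert (-1) I := by simp [hI1, h3.symm]
  have hm0 : (0 : K) ∉ insert 1 (insert (-1) I) := by simp [hI0]
  have hcard : #(insert 0 (insert 1 (insert (-1) I))) = n + 3 := by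
    rw [card_insert_of_notMem hm0, card_insert_of_notMem hm1, card_insert_of_notMem hm, hcardI]
  have hL := Lagrange.coeff_eq_sum (s := insert 0 (insert 1 (insert (-1) I))) (v := (id : K → K))
    (Function.injective_id.injOn) (P := P)
    (by rw [hcard]; exact (Polynomial.degree_le_natDegree).trans_lt (by norm_cast; omega))
  rw [hcard, Polynomial.coeff_eq_zero_of_natDegree_lt (by omega), sum_insert hm0, sum_insert hm1,
    sum_insert hm, hI, sum_image hx.injOn, ← hI] at hL
  simp only [id] at hL
  have e0 : ∏ t ∈ (insert 0 (insert 1 (insert (-1) I))).erase 0, ((0 : K) - t) =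
      -((-1) ^ n * ∏ j, x j) := by
    rw [erase_insert hm0, prod_insert hm1, prod_insert hm, hI, prod_image hx.injOn]
    simp [prod_neg]
  have e1 : ∏ t ∈ (insert 0 (insert 1 (insert (-1) I))).erase 1, ((1 : K) - t) =
      2 * ∏ j, (1 - x j) := by
    rw [erase_insert_of_ne zero_ne_one, erase_insert hm1, prod_insert (by simp [hI0]),
      prod_insert hm, hI, prod_image hx.injOn]
    ring
  have e2 : ∏ t ∈ (insert 0 (insert 1 (insert (-1) I))).erase (-1), ((-1 : K) - t) =
      2 * ((-1) ^ n * ∏ j, (1 + x j)) := by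
    rw [erase_insert_of_ne (by simp), erase_insert_of_ne h3.symm, erase_insert hm,
      prod_insert (by simp [hI0]), prod_insert hI1, hI, prod_image hx.injOn]
    have : ∏ j, (-1 - x j) = (-1) ^ n * ∏ j, (1 + x j) := by
      have h : ∀ j, -1 - x j = -1 * (1 + x j) := fun j => by ring
      simp only [h, prod_mul_distrib, prod_const, card_univ, Fintype.card_fin]
    rw [this]
    ring
  have e3 : ∀ i, ∏ t ∈ (insert 0 (insert 1 (insert (-1) I))).erase (x i), (x i - t) =
      x i * ((x i - 1) * ((x i + 1) * ∏ j ∈ univ.erase i, (x i - x j))) := by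
    intro i
    rw [erase_insert_of_ne (h0 i).symm, erase_insert_of_ne (h1 i).symm,
      erase_insert_of_ne (h2 i).symm, prod_insert (by simp [hI0]),
      prod_insert (by simp [hI1, h3.symm]),
      prod_insert (by simp [hI2]), hI, ← image_erase hx, prod_image hx.injOn]
    ring
  have p1 : ∏ j, (1 - x j) ≠ 0 := prod_ne_zero_iff.2 fun j _ => sub_ne_zero.2 (h1 j).symm
  have p2 : ∏ j, (1 + x j) ≠ 0 := prod_ne_zero_iff.2 fun j _ h => h2 j (by linear_combination h)
  have p0 : ∏ j, x j ≠ 0 := prod_ne_zero_iff.2 fun j _ => h0 j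
  have hsq : ((-1 : K) ^ n) * (-1) ^ n = 1 := by rw [← mul_pow]; simp
  have hs0 : ((-1 : K) ^ n) ≠ 0 := fun h => by rw [h] at hsq; simp at hsq
  have hterm : ∀ i, P.eval (x i) /
      ∏ t ∈ (insert 0 (insert 1 (insert (-1) I))).erase (x i), (x i - t) =
      ((-1) ^ n / ∏ j, x j) *
        ∏ j ∈ univ.erase i, (x j * (1 - x i * x j) / (x j - x i)) := by
    intro i
    rw [e3, hPeval, ← mul_prod_erase univ _ (mem_univ i), prod_div_distrib, prod_mul_distrib,
      ← mul_prod_erase univ x (mem_univ i)]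
    have q0 : ∏ j ∈ univ.erase i, x j ≠ 0 := prod_ne_zero_iff.2 fun j _ => h0 j
    have q1 : ∏ j ∈ univ.erase i, (x j - x i) ≠ 0 :=
      prod_ne_zero_iff.2 fun j hj => sub_ne_zero.2 (hx.ne (ne_of_mem_erase hj))
    have q2 : ∏ j ∈ univ.erase i, (x i - x j) =
        -((-1) ^ n * ∏ j ∈ univ.erase i, (x j - x i)) := by
      have : (-1 : K) ^ n = -(-1) ^ #(univ.erase i) := by
        rw [card_erase_of_mem (mem_univ i), card_fin]
        have : n = (n - 1) + 1 := by have := i.pos; omega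
        conv_lhs => rw [this, pow_succ]
        ring
      rw [this, ← prod_const, neg_mul, neg_neg, ← prod_mul_distrib]
      exact prod_congr rfl fun j _ => by ring
    have q3 : ∏ j ∈ univ.erase i, (1 - x j * x i) = ∏ j ∈ univ.erase i, (1 - x i * x j) :=
      prod_congr rfl fun j _ => by ring
    have q4 : x i - 1 ≠ 0 := sub_ne_zero.2 (h1 i)
    have q5 : x i + 1 ≠ 0 := fun h => h2 i (by linear_combination h)
    rw [q2, q3]
    have q6 := h0 i
    field_simp
    linear_combination
      (-(∏ j ∈ univ.erase i, (1 - x i * x j)) * (x i - 1) * (x i + 1)) * hsq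
  simp only [hterm] at hL
  rw [← mul_sum, e0, e1, e2, hPeval, hPeval, hPeval] at hL
  simp only [mul_zero, sub_zero, prod_const_one, mul_one, mul_neg, sub_neg_eq_add] at hL
  set S := ∑ i, ∏ j ∈ univ.erase i, (x j * (1 - x i * x j) / (x j - x i))
  field_simp at hL
  rcases Nat.even_or_odd n with hn | hn
  · rw [if_pos hn]
    simp only [hn.neg_one_pow] at hL
    linear_combination (-1/2) * hL
  · rw [if_neg (Nat.not_even_iff_odd.2 hn)]
    simp only [hn.neg_one_pow] at hL
    linear_combination (-1/2) * hL

/-- In a product over all pairs `a < b`, the factors with `a = i` or `b = i` can be split off. -/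
theorem prod_pairs_split {M : Type*} [CommMonoid M] (g : Fin n → Fin n → M) (i : Fin n) :
    ∏ a, ∏ b ∈ Ioi a, g a b =
      ((∏ b ∈ Ioi i, g i b) * ∏ a ∈ Iio i, g a i) *
        ∏ a ∈ univ.erase i, ∏ b ∈ (Ioi a).erase i, g a b := by
  rw [← mul_prod_erase univ _ (mem_univ i), mul_assoc]
  congr 1
  have h1 : ∏ a ∈ Iio i, g a i = ∏ a ∈ univ.erase i, if a < i then g a i else 1 := by
    rw [← prod_filter]
    congr 1
    ext a
    simp only [mem_Iio, mem_filter, mem_erase, mem_univ, and_true]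
    exact ⟨fun h => ⟨h.ne, h⟩, fun h => h.2⟩
  rw [h1, ← prod_mul_distrib]
  refine prod_congr rfl fun a _ => ?_
  split_ifs with h
  · rw [mul_prod_erase _ _ (mem_Ioi.2 h)]
  · rw [one_mul, erase_eq_of_notMem (by simpa using h)]

theorem prod_erase_eq_Ioi_mul_Iio {M : Type*} [CommMonoid M] (g : Fin n → M) (i : Fin n) :
    ∏ j ∈ univ.erase i, g j = (∏ j ∈ Ioi i, g j) * ∏ j ∈ Iio i, g j := by
  rw [← prod_union]
  · congr 1
    ext j
    simp only [mem_erase, mem_univ, and_true, mem_union, mem_Ioi, mem_Iio]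
    exact ne_iff_lt_or_gt.trans or_comm
  · rw [disjoint_left]
    intro j h1 h2
    exact lt_asymm (mem_Ioi.1 h1) (mem_Iio.1 h2)

/-- The Vandermonde product `∏_{a < b} (x_a - x_b)`. -/
def vand {A : Type*} [CommRing A] (x : Fin n → A) : A := ∏ a, ∏ b ∈ Ioi a, (x a - x b)

/-- The product `∏_{a < b} (1 - x_a x_b)`. -/
def pairDen {A : Type*} [CommRing A] (x : Fin n → A) : A := ∏ a, ∏ b ∈ Ioi a, (1 - x a * x b)

theorem map_vand {A B : Type*} [CommRing A] [CommRing B] (φ : A →+* B) (x : Fin n → A) :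
    φ (vand x) = vand fun i => φ (x i) := by
  simp [vand]

theorem map_pairDen {A B : Type*} [CommRing A] [CommRing B] (φ : A →+* B) (x : Fin n → A) :
    φ (pairDen x) = pairDen fun i => φ (x i) := by
  simp [pairDen]

theorem pairDen_eq {A : Type*} [CommRing A] (x : Fin n → A) (i : Fin n) :
    pairDen x = (∏ j ∈ univ.erase i, (1 - x i * x j)) * pairDen (Function.update x i 0) := by
  rw [pairDen, prod_pairs_split _ i, pairDen, prod_pairs_split _ i,
    prod_erase_eq_Ioi_mul_Iio (fun j => 1 - x i * x j)]
  have h1 : ∀ a ∈ univ.erase i, ∏ b ∈ (Ioi a).erase i,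
      (1 - Function.update x i 0 a * Function.update x i 0 b) =
      ∏ b ∈ (Ioi a).erase i, (1 - x a * x b) := fun a ha => prod_congr rfl fun b hb => by
    rw [Function.update_of_ne (ne_of_mem_erase ha), Function.update_of_ne (ne_of_mem_erase hb)]
  rw [prod_congr rfl h1]
  simp [mul_comm (x i)]

/-- As a function of its `i`-th argument alone, the Vandermonde product is a constant multiple of
the product of the linear factors that vanish at the other arguments. -/
theorem vand_update {A : Type*} [CommRing A] (x : Fin n → A) (i : Fin n) :
    ∃ c : A, ∀ t, vand (Function.update x i t) = c * ∏ j ∈ univ.erase i, (x j - t) := by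
  refine ⟨(-1) ^ #(Ioi i) * ∏ a ∈ univ.erase i, ∏ b ∈ (Ioi a).erase i, (x a - x b), fun t => ?_⟩
  rw [vand, prod_pairs_split _ i, prod_erase_eq_Ioi_mul_Iio (fun j => x j - t)]
  have h1 : ∀ a ∈ univ.erase i, ∏ b ∈ (Ioi a).erase i,
      (Function.update x i t a - Function.update x i t b) =
      ∏ b ∈ (Ioi a).erase i, (x a - x b) := fun a ha => prod_congr rfl fun b hb => by
    rw [Function.update_of_ne (ne_of_mem_erase ha), Function.update_of_ne (ne_of_mem_erase hb)]
  have h2 : ∏ b ∈ Ioi i, (Function.update x i t i - Function.update x i t b) =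
      (-1) ^ #(Ioi i) * ∏ b ∈ Ioi i, (x b - t) := by
    rw [← prod_const, ← prod_mul_distrib]
    refine prod_congr rfl fun b hb => ?_
    rw [Function.update_self, Function.update_of_ne (mem_Ioi.1 hb).ne']
    ring
  have h3 : ∏ a ∈ Iio i, (Function.update x i t a - Function.update x i t i) =
      ∏ a ∈ Iio i, (x a - t) := by
    refine prod_congr rfl fun b hb => ?_
    rw [Function.update_self, Function.update_of_ne (mem_Iio.1 hb).ne]
  rw [prod_congr rfl h1, h2, h3]
  ring

theorem sum_vand_update_field {K : Type*} [Field K] [CharZero K] {x : Fin n → K}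
    (hx : Function.Injective x) (h0 : ∀ i, x i ≠ 0) (h1 : ∀ i, x i ≠ 1) (h2 : ∀ i, x i ≠ -1) :
    ∑ i, (∏ j ∈ univ.erase i, (1 - x i * x j)) * vand (Function.update x i 0) =
      vand x * (1 - if Even n then ∏ j, x j else 0) := by
  rw [← sum_prod_div_eq hx h0 h1 h2, mul_sum]
  refine sum_congr rfl fun i _ => ?_
  obtain ⟨c, hc⟩ := vand_update x i
  have hv : vand x = c * ∏ j ∈ univ.erase i, (x j - x i) := by
    rw [← hc, Function.update_eq_self]
  have q1 : ∏ j ∈ univ.erase i, (x j - x i) ≠ 0 :=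
    prod_ne_zero_iff.2 fun j hj => sub_ne_zero.2 (hx.ne (ne_of_mem_erase hj))
  rw [hv, hc, prod_div_distrib, prod_mul_distrib]
  simp only [sub_zero]
  field_simp

theorem X_ne_of_constantCoeff {i : Fin n} {a : MvPowerSeries (Fin n) ℝ}
    (ha : constantCoeff a ≠ 0) : X i ≠ a := by
  rintro rfl
  simp at ha

theorem X_ne_zero (i : Fin n) : (X i : MvPowerSeries (Fin n) ℝ) ≠ 0 := by
  intro h
  have := congrArg (coeff (Finsupp.single i 1)) h
  simp at this

instance : IsDomain (MvPowerSeries (Fin n) ℝ) := NoZeroDivisors.to_isDomain _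

/-- The identity of `sum_vand_update_field` for formal variables, obtained in the fraction field. -/
theorem sum_vand_update :
    ∑ i, (∏ j ∈ univ.erase i, (1 - X i * X j)) * vand (Function.update X i 0) =
      vand (X : Fin n → MvPowerSeries (Fin n) ℝ) * (1 - if Even n then ∏ j, X j else 0) := by
  set K := FractionRing (MvPowerSeries (Fin n) ℝ)
  set φ : MvPowerSeries (Fin n) ℝ →+* K := algebraMap _ _
  have hφ : Function.Injective φ := IsFractionRing.injective (MvPowerSeries (Fin n) ℝ) K
  have : CharZero (MvPowerSeries (Fin n) ℝ) := algebraRat.charZero _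
  have : CharZero K := charZero_of_injective_ringHom hφ
  have h := sum_vand_update_field (K := K) (x := fun i => φ (X i))
    (hφ.comp fun i j h => (X_inj.1 h))
    (fun i => by rw [Ne, map_eq_zero_iff φ hφ]; exact X_ne_zero i)
    (fun i => by
      rw [← map_one φ]; exact hφ.ne (X_ne_of_constantCoeff (by simp)))
    (fun i => by
      rw [← map_one φ, ← map_neg]; exact hφ.ne (X_ne_of_constantCoeff (by simp)))
  apply hφ
  have e : ∀ i : Fin n, Function.update (fun i => φ (X i)) i 0 =
      fun j => φ (Function.update X i 0 j) := fun i => by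
    ext j
    by_cases hj : j = i
    · subst hj; simp
    · simp [hj]
  simp only [e, ← map_vand, ← map_prod, ← map_mul, ← map_one φ, ← map_sub] at h
  rw [← map_sum] at h
  rw [h, map_mul, map_sub]
  congr 2
  split_ifs <;> simp

/-- The substitution `x_i = 0`. -/
def setZero (i : Fin n) : MvPowerSeries (Fin n) ℝ →ₐ[ℝ] MvPowerSeries (Fin n) ℝ :=
  (rename (Function.Embedding.subtype fun j => j ≠ i)).comp
    (killCompl (Function.Embedding.subtype fun j => j ≠ i))

theorem setZero_X (i j : Fin n) : setZero i (X j) = Function.update X i 0 j := by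
  rw [setZero, AlgHom.comp_apply]
  by_cases h : j = i
  · subst h
    rw [killCompl_X_eq_zero (by simp), map_zero, Function.update_self]
  · have := killCompl_X (R := ℝ) (e := Function.Embedding.subtype fun j => j ≠ i) ⟨j, h⟩
    simp only [Function.Embedding.subtype_apply] at this
    rw [this, rename_X, Function.update_of_ne h]
    rfl

theorem coeff_setZero {i : Fin n} {d : Fin n →₀ ℕ} (hd : d i ≠ 0) (f : MvPowerSeries (Fin n) ℝ) :
    coeff d (setZero i f) = 0 := by
  classical
  refine coeff_rename_eq_zero _ _ ?_
  rintro ⟨d', rfl⟩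
  refine hd (Finsupp.mapDomain_of_notMem_range _ _ ?_)
  simp

/-- The series `∏_{a<b} (x_a - x_b) / (1 - x_a x_b)`. -/
def littlewood (n : ℕ) : MvPowerSeries (Fin n) ℝ := vand X * (pairDen X)⁻¹

theorem constantCoeff_pairDen :
    constantCoeff (pairDen (X : Fin n → MvPowerSeries (Fin n) ℝ)) = 1 := by
  simp [pairDen]

theorem pairDen_mul_inv :
    pairDen (X : Fin n → MvPowerSeries (Fin n) ℝ) * (pairDen X)⁻¹ = 1 :=
  MvPowerSeries.mul_inv_cancel _ (by simp [constantCoeff_pairDen])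

theorem setZero_littlewood (i : Fin n) :
    setZero i (littlewood n) =
      (∏ j ∈ univ.erase i, (1 - X i * X j)) * vand (Function.update X i 0) * (pairDen X)⁻¹ := by
  have h1 : setZero i (vand X) = vand (Function.update X i 0) := by
    have := map_vand (setZero i).toRingHom (X : Fin n → MvPowerSeries (Fin n) ℝ)
    simpa [setZero_X] using this
  have h2 : setZero i (pairDen X) = pairDen (Function.update X i 0) := by
    have := map_pairDen (setZero i).toRingHom (X : Fin n → MvPowerSeries (Fin n) ℝ)
    simpa [setZero_X] using this
  have h3 := congrArg (setZero i) (pairDen_mul_inv (n := n))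
  rw [map_mul, map_one, h2] at h3
  have h4 := pairDen_mul_inv (n := n)
  rw [pairDen_eq X i] at h4
  rw [littlewood, map_mul, h1]
  rw [pairDen_eq X i] at h3 ⊢
  linear_combination
    vand (Function.update X i 0) * (∏ j ∈ univ.erase i, (1 - X i * X j)) *
      ((∏ j ∈ univ.erase i, (1 - X i * X j)) * pairDen (Function.update X i 0))⁻¹ * h3 -
    vand (Function.update X i 0) * setZero i
      ((∏ j ∈ univ.erase i, (1 - X i * X j)) * pairDen (Function.update X i 0))⁻¹ * h4

/-- The key identity: up to a factor `1 - x_1 ⋯ x_n` when `n` is even, the series `littlewood n` is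
a sum of series each of which does not involve one of the variables. -/
theorem littlewood_mul :
    littlewood n * (1 - if Even n then ∏ j, X j else 0) = ∑ i, setZero i (littlewood n) := by
  simp only [setZero_littlewood, ← sum_mul, sum_vand_update]
  rw [littlewood]
  ring

theorem prod_X_eq_mon : ∏ j, (X j : MvPowerSeries (Fin n) ℝ) = mon 1 := by
  have := colProd_var (n := n) (c := range n) subset_rfl
  rw [prod_range] at this
  convert! this using 1
  · simp [var]
  · congr 1; ext i; simp

/-- Lowering all exponents by one does not change a coefficient if the number of variables is even;
if it is odd, then the coefficients at exponent vectors without zeros vanish. -/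
theorem coeff_littlewood_add_one (β : Fin n → ℕ) :
    coeff (expo (β + 1)) (littlewood n) =
      if Even n then coeff (expo β) (littlewood n) else 0 := by
  have h := congrArg (coeff (expo (β + 1))) (littlewood_mul (n := n))
  rw [map_sum, sum_eq_zero fun i _ => coeff_setZero (by simp) _, mul_sub, mul_one, map_sub,
    sub_eq_zero] at h
  rw [h]
  split_ifs
  · rw [prod_X_eq_mon, expo_add, mon, coeff_add_mul_monomial, mul_one]
  · simp

theorem prod_pairs_castSucc {M : Type*} [CommMonoid M] (g : Fin (n + 1) → Fin (n + 1) → M) :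
    ∏ a, ∏ b ∈ Ioi a, g a b =
      (∏ a : Fin n, g a.castSucc (Fin.last n)) *
        ∏ a : Fin n, ∏ b ∈ Ioi a, g a.castSucc b.castSucc := by
  rw [prod_pairs_split _ (Fin.last n)]
  have h1 : Ioi (Fin.last n) = ∅ := by ext i; simp [Fin.le_last]
  have h2 : Iio (Fin.last n) = univ.map Fin.castSuccEmb := by
    ext i; simp [Fin.exists_castSucc_eq]
  have h3 : univ.erase (Fin.last n) = univ.map Fin.castSuccEmb := by
    ext i; simp [Fin.exists_castSucc_eq]
  have h4 : ∀ a : Fin n, (Ioi a.castSucc).erase (Fin.last n) = (Ioi a).map Fin.castSuccEmb := by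
    intro a
    rw [Fin.map_castSuccEmb_Ioi]
    ext i
    simp [Fin.lt_last_iff_ne_last, and_comm]
  rw [h1, h2, h3, prod_empty, one_mul, prod_map, prod_map]
  simp only [Fin.castSuccEmb_apply, h4, prod_map]

theorem killCompl_castSucc_X_castSucc (i : Fin n) :
    killCompl (R := ℝ) Fin.castSuccEmb (X i.castSucc) = X i :=
  killCompl_X (e := Fin.castSuccEmb) i

theorem killCompl_castSucc_X_last :
    killCompl (R := ℝ) (Fin.castSuccEmb (n := n)) (X (Fin.last n)) = 0 :=
  killCompl_X_eq_zero (by simp)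

theorem killCompl_littlewood :
    killCompl Fin.castSuccEmb (littlewood (n + 1)) = mon 1 * littlewood n := by
  have h1 : killCompl (R := ℝ) Fin.castSuccEmb (vand (X : Fin (n + 1) → _)) = mon 1 * vand X := by
    rw [vand, prod_pairs_castSucc, map_mul, map_prod, map_prod]
    simp only [map_prod, map_sub, killCompl_castSucc_X_castSucc, killCompl_castSucc_X_last,
      sub_zero, prod_X_eq_mon, vand]
  have h2 : killCompl (R := ℝ) Fin.castSuccEmb (pairDen (X : Fin (n + 1) → _)) = pairDen X := by
    rw [pairDen, prod_pairs_castSucc, map_mul, map_prod, map_prod]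
    simp only [map_prod, map_sub, map_mul, map_one, killCompl_castSucc_X_castSucc,
      killCompl_castSucc_X_last, mul_zero, sub_zero, prod_const_one, one_mul, pairDen]
  have h3 := congrArg (killCompl (R := ℝ) Fin.castSuccEmb) (pairDen_mul_inv (n := n + 1))
  rw [map_mul, map_one, h2] at h3
  have h4 := pairDen_mul_inv (n := n)
  rw [littlewood, map_mul, h1, littlewood]
  linear_combination mon 1 * vand X * (pairDen X)⁻¹ * h3 -
    mon 1 * vand X * killCompl Fin.castSuccEmb (pairDen X)⁻¹ * h4

/-- The coefficients at exponent vectors with last entry zero reduce to fewer variables. -/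
theorem coeff_littlewood_snoc (β : Fin n → ℕ) :
    coeff (expo (Fin.snoc (α := fun _ => ℕ) (β + 1) 0)) (littlewood (n + 1)) =
      coeff (expo β) (littlewood n) := by
  have h := congrArg (coeff (expo (β + 1))) (killCompl_littlewood (n := n))
  rw [coeff_killCompl, add_comm β 1, expo_add, mon, coeff_add_monomial_mul, one_mul] at h
  rw [← h, ← expo_add, add_comm 1 β]
  congr 2
  ext i
  refine Fin.lastCases ?_ (fun j => ?_) i
  · rw [Finsupp.embDomain_of_notMem_range _ _ _ (by simp)]
    simp
  · have := Finsupp.embDomain_apply_self Fin.castSuccEmb (expo (β + 1)) j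
    simp only [Fin.castSuccEmb_apply] at this
    rw [this]
    simp

/-- The Littlewood identity, in the form that `∏_{a<b} (x_a - x_b) / (1 - x_a x_b)` is a nonnegative
combination of alternants. The two reduction steps for the coefficients lower either the number of
variables or the last exponent, and preserve strictly decreasing exponent vectors. -/
theorem coeff_littlewood_nonneg :
    ∀ {n : ℕ} {β : Fin n → ℕ}, StrictAnti β → 0 ≤ coeff (expo β) (littlewood n) := by
  intro n
  induction n with
  | zero =>
    intro β _
    have h1 : littlewood 0 = 1 := by
      simp [littlewood, vand, pairDen]
    have h2 : expo β = 0 := by ext i; exact i.elim0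
    rw [h1, h2]
    simp
  | succ n ih =>
    intro β hβ
    obtain ⟨b, hb⟩ : ∃ b, β (Fin.last n) = b := ⟨_, rfl⟩
    induction b generalizing β with
    | zero =>
      obtain ⟨γ, rfl⟩ : ∃ γ : Fin n → ℕ, β = Fin.snoc (α := fun _ => ℕ) (γ + 1) 0 := by
        refine ⟨fun i => β i.castSucc - 1, ?_⟩
        ext i
        refine Fin.lastCases ?_ (fun j => ?_) i
        · simp [hb]
        · have := hβ (Fin.castSucc_lt_last j)
          simp
          omega
      rw [coeff_littlewood_snoc]
      refine ih fun i j hij => ?_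
      have := hβ (Fin.castSucc_lt_castSucc_iff.2 hij)
      simpa using this
    | succ b ihb =>
      obtain ⟨γ, rfl⟩ : ∃ γ : Fin (n + 1) → ℕ, β = γ + 1 := by
        refine ⟨fun i => β i - 1, ?_⟩
        ext i
        have := hβ.antitone (Fin.le_last i)
        simp
        omega
      rw [coeff_littlewood_add_one]
      split_ifs
      · refine ihb (fun i j hij => ?_) (by simpa using hb)
        have := hβ hij
        simpa using this
      · exact le_rfl

/-! ### Tableaux as sequences of columns -/

open Classical in
/-- The sequences of columns enumerated by `columnSum`, extended by empty columns. -/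
def chains (n : ℕ) (l : ℕ → ℕ) : ℕ → Finset ℕ → Finset (ℕ → Finset ℕ)
  | 0, _ => {fun _ => ∅}
  | m + 1, c => {c' ∈ (range n).powersetCard (l m) | ColLE c' c}.biUnion fun c' =>
      (chains n l m c').image fun f => Function.update f m c'

theorem mem_chains {l : ℕ → ℕ} {m : ℕ} : ∀ {c : Finset ℕ} {f : ℕ → Finset ℕ},
    f ∈ chains n l m c ↔ (∀ j < m, f j ⊆ range n ∧ #(f j) = l j) ∧ (∀ j, m ≤ j → f j = ∅) ∧
      ∀ j < m, ColLE (f j) (if j + 1 = m then c else f (j + 1)) := by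
  classical
  induction m with
  | zero =>
    intro c f
    simp only [chains, mem_singleton, funext_iff]
    simp
  | succ m ih =>
    intro c f
    simp only [chains, mem_biUnion, mem_filter, mem_powersetCard, mem_image, ih]
    constructor
    · rintro ⟨c', ⟨⟨h1, h2⟩, h3⟩, g, ⟨h4, h5, h6⟩, rfl⟩
      refine ⟨fun j hj => ?_, fun j hj => ?_, fun j hj => ?_⟩
      · rcases Nat.lt_succ_iff_lt_or_eq.1 hj with h | rfl
        · rw [Function.update_of_ne h.ne]
          exact h4 j h
        · rw [Function.update_self]
          exact ⟨h1, h2⟩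
      · rw [Function.update_of_ne (by omega)]
        exact h5 j (by omega)
      · rcases Nat.lt_succ_iff_lt_or_eq.1 hj with h | rfl
        · rw [Function.update_of_ne h.ne, if_neg (by omega)]
          have := h6 j h
          by_cases hjm : j + 1 = m
          · subst hjm
            rw [Function.update_self]
            rwa [if_pos rfl] at this
          · rw [Function.update_of_ne hjm]
            rwa [if_neg hjm] at this
        · rw [Function.update_self, if_pos rfl]
          exact h3
    · rintro ⟨h1, h2, h3⟩
      refine ⟨f m, ⟨h1 m (by omega), by simpa using h3 m (by omega)⟩, Function.update f m ∅,
        ⟨fun j hj => ?_, fun j hj => ?_, fun j hj => ?_⟩, by simp⟩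
      · rw [Function.update_of_ne hj.ne]
        exact h1 j (by omega)
      · rcases eq_or_ne j m with rfl | h
        · simp
        · rw [Function.update_of_ne h]
          exact h2 j (by omega)
      · rw [Function.update_of_ne hj.ne]
        have := h3 j (by omega)
        rw [if_neg (by omega)] at this
        split_ifs with h
        · rwa [← h]
        · rwa [Function.update_of_ne h]

theorem columnSum_eq_sum_chains {A : Type*} [CommSemiring A] (y : ℕ → A) (l : ℕ → ℕ) (m : ℕ) :
    ∀ c : Finset ℕ, columnSum y n l m c = ∑ f ∈ chains n l m c, ∏ j ∈ range m, ∏ i ∈ f j, y i := by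
  classical
  induction m with
  | zero =>
    intro c
    simp [columnSum, chains]
  | succ m ih =>
    intro c
    rw [columnSum, chains, sum_biUnion]
    · refine sum_congr rfl fun c' _ => ?_
      rw [sum_image, ih, mul_sum]
      · refine sum_congr rfl fun f _ => ?_
        rw [prod_range_succ, Function.update_self, mul_comm]
        congr 1
        refine prod_congr rfl fun j hj => ?_
        rw [Function.update_of_ne (mem_range.1 hj).ne]
      · intro f hf g hg hfg
        have hf := (mem_chains.1 hf).2.1 m le_rfl
        have hg := (mem_chains.1 hg).2.1 m le_rfl
        ext1 j
        rcases eq_or_ne j m with rfl | h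
        · rw [hf, hg]
        · have := congrFun hfg j
          simpa [h] using this
    · intro c1 _ c2 _ hne
      rw [Function.onFun, disjoint_left]
      intro f h1 h2
      simp only [mem_image] at h1 h2
      obtain ⟨g1, _, rfl⟩ := h1
      obtain ⟨g2, _, h⟩ := h2
      have := congrFun h m
      simp only [Function.update_self] at this
      exact hne this.symm

theorem prod_mon {ι : Type*} (s : Finset ι) (α : ι → Fin n → ℕ) :
    ∏ j ∈ s, mon (α j) = mon (∑ j ∈ s, α j) := by
  classical
  induction s using Finset.induction_on with
  | empty =>
    simp only [prod_empty, sum_empty]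
    have : expo (0 : Fin n → ℕ) = 0 := by ext; simp
    rw [mon, this]
    rfl
  | insert a s ha ih => rw [prod_insert ha, sum_insert ha, ih, mon_add]

theorem coeff_columnSum (l : ℕ → ℕ) (m : ℕ) (c : Finset ℕ) (β : Fin n → ℕ) :
    coeff (expo β) (columnSum (var n) n l m c) =
      #{f ∈ chains n l m c | β = ∑ j ∈ range m, colInd n (f j)} := by
  rw [columnSum_eq_sum_chains, map_sum, card_eq_sum_ones, sum_filter, Nat.cast_sum]
  refine sum_congr rfl fun f hf => ?_
  have : ∏ j ∈ range m, ∏ i ∈ f j, var n i = mon (∑ j ∈ range m, colInd n (f j)) := by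
    rw [← prod_mon]
    exact prod_congr rfl fun j hj => colProd_var ((mem_chains.1 hf).1 j (mem_range.1 hj)).1
  rw [this, coeff_mon]
  simp

theorem below_lt_below {c : Finset ℕ} {a b : ℕ} (ha : a ∈ c) (hab : a < b) :
    below c a < below c b := by
  refine card_lt_card ⟨fun i hi => ?_, fun h => ?_⟩
  · rw [mem_filter] at hi ⊢
    exact ⟨hi.1, hi.2.trans hab⟩
  · have := h (mem_filter.2 ⟨ha, hab⟩)
    simp at this

theorem eq_of_below_eq {c : Finset ℕ} {a b : ℕ} (ha : a ∈ c) (hb : b ∈ c)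
    (h : below c a = below c b) : a = b := by
  rcases lt_trichotomy a b with h1 | h1 | h1
  · exact absurd h (below_lt_below ha h1).ne
  · exact h1
  · exact absurd h (below_lt_below hb h1).ne'

theorem below_eq_count (c : Finset ℕ) (m : ℕ) : below c m = Nat.count (· ∈ c) m := by
  rw [Nat.count_eq_card_filter_range, below]
  congr 1
  ext i
  simp [and_comm]

section Tableau

variable {μ : YoungDiagram}

/-- The set of entries in column `j` of a tableau. -/
def colSet (T : SemistandardYoungTableau μ) (j : ℕ) : Finset ℕ :=
  (range (μ.colLen j)).image fun i => T i j

theorem tableau_col_strictMonoOn (T : SemistandardYoungTableau μ) (j : ℕ) :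
    StrictMonoOn (fun i => T i j) (range (μ.colLen j) : Set ℕ) := fun _ _ _ h2 h =>
  T.col_strict h (YoungDiagram.mem_iff_lt_colLen.2 (by simpa using h2))

theorem card_colSet (T : SemistandardYoungTableau μ) (j : ℕ) : #(colSet T j) = μ.colLen j := by
  rw [colSet, card_image_of_injOn (tableau_col_strictMonoOn T j).injOn, card_range]

theorem below_colSet (T : SemistandardYoungTableau μ) (j m : ℕ) :
    below (colSet T j) m = #{i ∈ range (μ.colLen j) | T i j < m} := by
  rw [below, colSet, filter_image, card_image_of_injOn]
  exact (tableau_col_strictMonoOn T j).injOn.mono (coe_subset.2 (filter_subset _ _))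

theorem below_colSet_entry (T : SemistandardYoungTableau μ) {i j : ℕ} (hi : i < μ.colLen j) :
    below (colSet T j) (T i j) = i := by
  rw [below_colSet]
  have : {i' ∈ range (μ.colLen j) | T i' j < T i j} = range i := by
    ext i'
    simp only [mem_filter, mem_range]
    constructor
    · rintro ⟨h1, h2⟩
      exact ((tableau_col_strictMonoOn T j).lt_iff_lt (by simpa using h1) (by simpa using hi)).1 h2
    · intro h
      exact ⟨h.trans hi, T.col_strict h (YoungDiagram.mem_iff_lt_colLen.2 hi)⟩
  rw [this, card_range]

theorem colLE_colSet (T : SemistandardYoungTableau μ) (j : ℕ) :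
    ColLE (colSet T j) (colSet T (j + 1)) := by
  intro m
  rw [below_colSet, below_colSet]
  refine card_le_card fun i hi => ?_
  simp only [mem_filter, mem_range] at hi ⊢
  exact ⟨hi.1.trans_le (μ.colLen_anti _ _ (Nat.le_succ j)),
    (T.row_weak (Nat.lt_succ_self j) (YoungDiagram.mem_iff_lt_colLen.2 hi.1)).trans_lt hi.2⟩

theorem colSet_injective :
    Function.Injective (colSet : SemistandardYoungTableau μ → ℕ → Finset ℕ) := by
  intro T T' h
  ext i j
  by_cases hi : i < μ.colLen j
  · refine eq_of_below_eq (c := colSet T j) (mem_image_of_mem _ (mem_range.2 hi)) ?_ ?_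
    · rw [h]
      exact mem_image_of_mem _ (mem_range.2 hi)
    · rw [below_colSet_entry T hi, h, below_colSet_entry T' hi]
  · have : (i, j) ∉ μ := fun h => hi (YoungDiagram.mem_iff_lt_colLen.1 h)
    rw [T.zeros this, T'.zeros this]

/-- A compatible sequence of columns comes from a tableau: the entry in row `i` is the `i`-th
smallest element of the column, and `Nat.nth` takes the value `0` outside the diagram. -/
theorem exists_colSet_eq {f : ℕ → Finset ℕ} (hcard : ∀ j, #(f j) = μ.colLen j)
    (hle : ∀ j, ColLE (f j) (f (j + 1))) : ∃ T : SemistandardYoungTableau μ, colSet T = f := by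
  have hfin : ∀ j, (Set.ofPred fun x => x ∈ f j).Finite := fun j => (f j).finite_toSet
  have hc : ∀ j, #(hfin j).toFinset = μ.colLen j := fun j => by
    rw [← hcard j]
    congr 1
    ext i
    simp
  have hanti : ∀ m, Antitone fun j => below (f j) m := fun m =>
    antitone_nat_of_succ_le fun j => hle j m
  let T : SemistandardYoungTableau μ :=
    { entry := fun i j => Nat.nth (fun x => x ∈ f j) i
      row_weak' := by
        intro i j1 j2 hj hcell
        have hi := YoungDiagram.mem_iff_lt_colLen.1 hcell
        refine Nat.lt_succ_iff.1 (Nat.nth_lt_of_lt_count ?_)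
        rw [← below_eq_count]
        refine lt_of_lt_of_le ?_ (hanti _ hj.le)
        change i < below (f j2) _
        rw [below_eq_count, Nat.succ_eq_add_one, Nat.count_nth_succ]
        · exact Nat.lt_succ_self i
        · intro _
          rwa [hc]
      col_strict' := by
        intro i1 i2 j hi hcell
        refine Nat.nth_lt_nth_of_lt_card (hfin j) hi ?_
        rw [hc]
        exact YoungDiagram.mem_iff_lt_colLen.1 hcell
      zeros' := by
        intro i j hij
        refine Nat.nth_of_card_le (hfin j) ?_
        rw [hc]
        exact not_lt.1 fun h => hij (YoungDiagram.mem_iff_lt_colLen.2 h) }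
  refine ⟨T, funext fun j => eq_of_subset_of_card_le ?_ ?_⟩
  · intro x hx
    obtain ⟨i, hi, rfl⟩ := mem_image.1 hx
    exact Nat.nth_mem_of_lt_card (hfin j) (by rw [hc]; exact mem_range.1 hi)
  · rw [card_colSet, hcard]

theorem lt_rowLen_zero_of_mem {i j : ℕ} (h : (i, j) ∈ μ) : j < μ.rowLen 0 :=
  YoungDiagram.mem_iff_lt_rowLen.1 (μ.up_left_mem (Nat.zero_le i) le_rfl h)

theorem colLen_eq_zero {j : ℕ} (h : μ.rowLen 0 ≤ j) : μ.colLen j = 0 := by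
  by_contra hne
  have : (0, j) ∈ μ := YoungDiagram.mem_iff_lt_colLen.2 (Nat.pos_of_ne_zero hne)
  exact absurd (YoungDiagram.mem_iff_lt_rowLen.1 this) (not_lt.2 h)

theorem content_apply (T : SemistandardYoungTableau μ) (k : ℕ) :
    content T k = #{j ∈ range (μ.rowLen 0) | k ∈ colSet T j} := by
  classical
  have h1 : content T k = #{c ∈ μ.cells | T c.1 c.2 = k} := by
    rw [content, Finsupp.finsetSum_apply, card_filter]
    exact sum_congr rfl fun c _ => by rw [Finsupp.single_apply]
  rw [h1]
  refine card_nbij (fun c => c.2) ?_ ?_ ?_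
  · rintro ⟨i, j⟩ h
    simp only [mem_coe, mem_filter, YoungDiagram.mem_cells, mem_range] at h ⊢
    refine ⟨lt_rowLen_zero_of_mem h.1, mem_image.2 ⟨i, ?_, h.2⟩⟩
    exact mem_range.2 (YoungDiagram.mem_iff_lt_colLen.1 h.1)
  · rintro ⟨i, j⟩ h ⟨i', j'⟩ h' hj
    simp only [mem_coe, mem_filter, YoungDiagram.mem_cells] at h h' hj
    subst hj
    have hi := YoungDiagram.mem_iff_lt_colLen.1 h.1
    have hi' := YoungDiagram.mem_iff_lt_colLen.1 h'.1
    rw [(tableau_col_strictMonoOn T j).injOn (by simpa using hi) (by simpa using hi')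
      (h.2.trans h'.2.symm)]
  · intro j hj
    simp only [mem_coe, mem_filter] at hj
    obtain ⟨i, hi, h⟩ := mem_image.1 hj.2
    exact ⟨(i, j), by simpa [YoungDiagram.mem_iff_lt_colLen, h] using hi, rfl⟩

end Tableau

/-- The power series in `n` variables obtained by setting all other variables to zero. -/
def res (n : ℕ) : MvPowerSeries ℕ ℝ →ₐ[ℝ] MvPowerSeries (Fin n) ℝ := killCompl Fin.valEmbedding

theorem embDomain_val_apply (β : Fin n → ℕ) (k : Fin n) :
    Finsupp.embDomain Fin.valEmbedding (expo β) k = β k :=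
  Finsupp.embDomain_apply_self Fin.valEmbedding (expo β) k

theorem embDomain_val_of_le (β : Fin n → ℕ) {k : ℕ} (hk : n ≤ k) :
    Finsupp.embDomain Fin.valEmbedding (expo β) k = 0 :=
  Finsupp.embDomain_of_notMem_range _ _ _ (by simpa using hk)

/-- The Schur polynomial in `n` variables is the generating function of the sequences of columns. -/
theorem res_schur (μ : YoungDiagram) :
    res n (schur μ) = columnSum (var n) n μ.colLen (μ.rowLen 0) ∅ := by
  classical
  ext d
  obtain ⟨β, rfl⟩ := Finsupp.equivFunOnFinite.symm.surjective d
  change coeff (expo β) _ = coeff (expo β) _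
  rw [coeff_columnSum, res, coeff_killCompl]
  change ((Nat.card {T : SemistandardYoungTableau μ //
    content T = Finsupp.embDomain Fin.valEmbedding (expo β)} : ℕ) : ℝ) = _
  congr 1
  rw [← Nat.card_eq_finsetCard]
  have hsum : ∀ (T : SemistandardYoungTableau μ) (k : Fin n),
      (∑ j ∈ range (μ.rowLen 0), colInd n (colSet T j)) k = content T k := fun T k => by
    rw [content_apply, Finset.sum_apply, card_filter]
    rfl
  have hmem : ∀ T : SemistandardYoungTableau μ,
      content T = Finsupp.embDomain Fin.valEmbedding (expo β) →
      colSet T ∈ {f ∈ chains n μ.colLen (μ.rowLen 0) ∅ |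
        β = ∑ j ∈ range (μ.rowLen 0), colInd n (f j)} := by
    intro T hT
    rw [mem_filter, mem_chains]
    refine ⟨⟨fun j hj => ⟨fun k hk => ?_, card_colSet T j⟩, fun j hj => ?_, fun j hj => ?_⟩, ?_⟩
    · rw [mem_range]
      by_contra hkn
      have h1 : content T k = 0 := by rw [hT, embDomain_val_of_le β (not_lt.1 hkn)]
      rw [content_apply, card_eq_zero, filter_eq_empty_iff] at h1
      exact h1 (mem_range.2 hj) hk
    · rw [← card_eq_zero, card_colSet, colLen_eq_zero hj]
    · split_ifs
      · exact fun m => by simp [below]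
      · exact colLE_colSet T j
    · ext k
      rw [hsum, hT, embDomain_val_apply]
  refine Nat.card_eq_of_bijective (fun T => ⟨colSet T.1, hmem T.1 T.2⟩) ⟨?_, ?_⟩
  · intro T T' h
    exact Subtype.ext (colSet_injective (congrArg Subtype.val h))
  · rintro ⟨f, hf⟩
    rw [mem_filter, mem_chains] at hf
    obtain ⟨⟨h1, h2, h3⟩, h4⟩ := hf
    have hcard : ∀ j, #(f j) = μ.colLen j := fun j => by
      rcases lt_or_ge j (μ.rowLen 0) with hj | hj
      · exact (h1 j hj).2
      · rw [h2 j hj, colLen_eq_zero hj, card_empty]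
    have hsub : ∀ j, f j ⊆ range n := fun j => by
      rcases lt_or_ge j (μ.rowLen 0) with hj | hj
      · exact (h1 j hj).1
      · rw [h2 j hj]
        exact empty_subset _
    have hle : ∀ j, ColLE (f j) (f (j + 1)) := fun j => by
      rcases lt_or_ge (j + 1) (μ.rowLen 0) with hj | hj
      · have := h3 j (by omega)
        rwa [if_neg hj.ne] at this
      · rw [h2 (j + 1) hj]
        exact fun m => by simp [below]
    obtain ⟨T, rfl⟩ := exists_colSet_eq hcard hle
    refine ⟨⟨T, ?_⟩, rfl⟩
    ext k
    rcases lt_or_ge k n with hk | hk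
    · have := embDomain_val_apply β ⟨k, hk⟩
      simp only at this
      rw [this, h4]
      exact (hsum T ⟨k, hk⟩).symm
    · rw [embDomain_val_of_le β hk, content_apply, card_eq_zero, filter_eq_empty_iff]
      intro j _ hkj
      exact absurd (mem_range.1 (hsub j hkj)) (not_lt.2 hk)

/-! ### Antisymmetric series and Schur expansions -/

/-- A power series in finitely many variables is antisymmetric if permutations of the variables act
on it through their sign. -/
def IsAnti (f : MvPowerSeries (Fin n) ℝ) : Prop :=
  ∀ w : Equiv.Perm (Fin n), rename w f = ((Equiv.Perm.sign w : ℤ) : ℝ) • f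

theorem mon_eq_prod (α : Fin n → ℕ) : mon α = ∏ i, (X i : MvPowerSeries (Fin n) ℝ) ^ α i := by
  have h : ∀ i, (X i : MvPowerSeries (Fin n) ℝ) ^ α i = mon (Pi.single i (α i)) := fun i => by
    rw [X_pow_eq, mon]
    congr 1
    ext j
    simp
  simp only [h, prod_mon]
  congr 1
  exact (Finset.univ_sum_single α).symm

theorem alt_stair_eq_vand : alt (mon (stair n)) = vand X := by
  have h := Matrix.det_projVandermonde (1 : Fin n → MvPowerSeries (Fin n) ℝ) X
  simp only [Pi.one_apply, one_mul] at h
  rw [vand, ← h, Matrix.det_apply, alt]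
  refine sum_congr rfl fun w _ => ?_
  rw [mon_eq_prod, map_prod, Units.smul_def, ← Int.cast_smul_eq_zsmul ℝ]
  congr 1
  refine prod_congr rfl fun i _ => ?_
  rw [map_pow, rename_X, Matrix.projVandermonde_apply, Pi.one_apply, one_pow, one_mul]
  congr 1
  simp only [stair, Fin.val_rev]
  omega

theorem vand_isAnti : IsAnti (vand (X : Fin n → MvPowerSeries (Fin n) ℝ)) := fun w => by
  rw [← alt_stair_eq_vand, rename_alt]

theorem vand_ne_zero : vand (X : Fin n → MvPowerSeries (Fin n) ℝ) ≠ 0 := by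
  refine prod_ne_zero_iff.2 fun a _ => prod_ne_zero_iff.2 fun b hb => ?_
  exact sub_ne_zero.2 fun h => (mem_Ioi.1 hb).ne (X_inj.1 h)

theorem IsAnti.mul {f g : MvPowerSeries (Fin n) ℝ} (hf : IsAnti f) (hg : IsSymm g) :
    IsAnti (f * g) := fun w => by
  rw [map_mul, hf, hg, smul_mul_assoc]

theorem IsSymm.mul {f g : MvPowerSeries (Fin n) ℝ} (hf : IsSymm f) (hg : IsSymm g) :
    IsSymm (f * g) := fun w => by
  rw [map_mul, hf, hg]

theorem pairDen_isSymm : IsSymm (pairDen (X : Fin n → MvPowerSeries (Fin n) ℝ)) := by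
  intro w
  -- The product of `pairDen X` with the Vandermonde product is antisymmetric.
  have h := w.prod_Ioi_comp_eq_sign_mul_prod
    (f := fun i j => (X i - X j) * (1 - X i * X j : MvPowerSeries (Fin n) ℝ)) (fun i j => by ring)
  simp only [prod_mul_distrib] at h
  change vand (fun i => X (w i)) * pairDen (fun i => X (w i)) = _ * (vand X * pairDen X) at h
  have h1 : rename w (vand (X : Fin n → MvPowerSeries (Fin n) ℝ)) = vand fun i => X (w i) := by
    have := map_vand (rename w : _ →ₐ[ℝ] MvPowerSeries (Fin n) ℝ).toRingHom
      (X : Fin n → MvPowerSeries (Fin n) ℝ)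
    simpa using this
  have h2 : rename w (pairDen (X : Fin n → MvPowerSeries (Fin n) ℝ)) =
      pairDen fun i => X (w i) := by
    have := map_pairDen (rename w : _ →ₐ[ℝ] MvPowerSeries (Fin n) ℝ).toRingHom
      (X : Fin n → MvPowerSeries (Fin n) ℝ)
    simpa using this
  rw [← h1, ← h2, vand_isAnti] at h
  refine mul_left_cancel₀ vand_ne_zero ?_
  rcases Int.units_eq_one_or (Equiv.Perm.sign w) with hs | hs
  · simpa [hs] using h
  · simpa [hs] using h

theorem inv_pairDen_isSymm : IsSymm (pairDen (X : Fin n → MvPowerSeries (Fin n) ℝ))⁻¹ := by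
  intro w
  have h1 := pairDen_mul_inv (n := n)
  have h2 := congrArg (rename w) h1
  rw [map_mul, map_one, pairDen_isSymm] at h2
  linear_combination (pairDen X)⁻¹ * h2 - rename w (pairDen X)⁻¹ * h1

theorem littlewood_isAnti : IsAnti (littlewood n) := vand_isAnti.mul inv_pairDen_isSymm

theorem exists_perm_strictAnti {α : Fin n → ℕ} (hα : Function.Injective α) :
    ∃ w : Equiv.Perm (Fin n), StrictAnti (α ∘ w) := by
  refine ⟨Tuple.sort α * Fin.revPerm, ?_⟩
  refine Antitone.strictAnti_of_injective (fun i j hij => ?_) (hα.comp (Equiv.injective _))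
  exact Tuple.monotone_sort α (Fin.rev_le_rev.2 hij)

theorem IsAnti.coeff_eq_zero {f : MvPowerSeries (Fin n) ℝ} (hf : IsAnti f) {α : Fin n → ℕ}
    (hα : ¬ Function.Injective α) : coeff (expo α) f = 0 := by
  simp only [Function.Injective, not_forall] at hα
  obtain ⟨i, j, hij, hne⟩ := hα
  have h := congrArg (coeff (expo α)) (hf (Equiv.swap i j))
  have h2 : α ∘ Equiv.swap i j = α := by
    ext k
    simp only [Function.comp, Equiv.swap_apply_def]
    split_ifs with h1 h2
    · rw [h1, hij]
    · rw [h2, hij]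
    · rfl
  rw [coeff_rename_perm, h2, Equiv.Perm.sign_swap hne, map_smul] at h
  simp at h
  linarith

theorem IsAnti.coeff_comp {f : MvPowerSeries (Fin n) ℝ} (hf : IsAnti f) (α : Fin n → ℕ)
    (w : Equiv.Perm (Fin n)) :
    coeff (expo (α ∘ w)) f = ((Equiv.Perm.sign w : ℤ) : ℝ) * coeff (expo α) f := by
  rw [← coeff_rename_perm, hf, map_smul, smul_eq_mul]

/-- An antisymmetric power series is determined by its coefficients at strictly decreasing exponent
vectors. -/
theorem IsAnti.ext {f g : MvPowerSeries (Fin n) ℝ} (hf : IsAnti f) (hg : IsAnti g)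
    (h : ∀ β : Fin n → ℕ, StrictAnti β → coeff (expo β) f = coeff (expo β) g) : f = g := by
  ext d
  obtain ⟨α, rfl⟩ := Finsupp.equivFunOnFinite.symm.surjective d
  change coeff (expo α) _ = coeff (expo α) _
  by_cases hα : Function.Injective α
  · obtain ⟨w, hw⟩ := exists_perm_strictAnti hα
    have h1 := h _ hw
    rw [hf.coeff_comp, hg.coeff_comp] at h1
    linear_combination ((Equiv.Perm.sign w : ℤ) : ℝ) * h1 -
      (coeff (expo α) f - coeff (expo α) g) * sign_mul_sign w
  · rw [hf.coeff_eq_zero hα, hg.coeff_eq_zero hα]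

theorem IsAnti.alt_eq {f : MvPowerSeries (Fin n) ℝ} (hf : IsAnti f) :
    alt f = (n.factorial : ℝ) • f := by
  simp only [alt, hf _, smul_smul, sign_mul_sign]
  rw [sum_const, card_univ, Fintype.card_perm, Fintype.card_fin, one_smul, Nat.cast_smul_eq_nsmul]

theorem continuous_coeff_alt_mul (β : Fin n → ℕ) (g : MvPowerSeries (Fin n) ℝ) :
    Continuous fun f => coeff (expo β) (alt (f * g)) := by
  simp only [coeff_alt]
  exact continuous_finsetSum _ fun w _ => continuous_const.mul
    ((WithPiTopology.continuous_coeff ℝ _).comp (continuous_mul_const g))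

/-- If multiplication by the symmetric series `g` turns alternants into nonnegative combinations of
alternants, then it preserves nonnegativity of the coefficients at strictly decreasing exponents of
antisymmetric series. -/
theorem IsAnti.coeff_mul_nonneg {f g : MvPowerSeries (Fin n) ℝ} (hf : IsAnti f) (hg : IsSymm g)
    (hf0 : ∀ γ : Fin n → ℕ, StrictAnti γ → 0 ≤ coeff (expo γ) f) {β : Fin n → ℕ}
    (hg0 : ∀ γ : Fin n → ℕ, StrictAnti γ → 0 ≤ coeff (expo β) (alt (mon γ * g))) :
    0 ≤ coeff (expo β) (f * g) := by
  -- Antisymmetrization multiplies `f * g` by `n!`, and may be applied monomial by monomial.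
  have key : 0 ≤ coeff (expo β) (alt (f * g)) := by
    let Φ : MvPowerSeries (Fin n) ℝ →+ ℝ :=
      { toFun := fun f => coeff (expo β) (alt (f * g))
        map_zero' := by simp [alt]
        map_add' := fun a b => by simp [coeff_alt, add_mul, mul_add, sum_add_distrib] }
    have h1 := (WithPiTopology.hasSum_of_monomials_self f).map Φ (continuous_coeff_alt_mul β g)
    refine h1.nonneg fun d => ?_
    obtain ⟨α, rfl⟩ := Finsupp.equivFunOnFinite.symm.surjective d
    change 0 ≤ coeff (expo β) (alt (monomial (expo α) (coeff (expo α) f) * g))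
    have h2 : monomial (expo α) (coeff (expo α) f) = coeff (expo α) f • mon α := by
      rw [mon, ← map_smul, smul_eq_mul, mul_one]
    rw [h2, smul_mul_assoc, alt_smul, map_smul, smul_eq_mul]
    by_cases hα : Function.Injective α
    · obtain ⟨w, hw⟩ := exists_perm_strictAnti hα
      have h3 : mon α * g = rename w (mon (α ∘ w) * g) := by rw [map_mul, rename_mon, hg]
      rw [h3, alt_rename, map_smul, smul_eq_mul, ← mul_assoc, mul_comm (coeff (expo α) f),
        ← hf.coeff_comp]
      exact mul_nonneg (hf0 _ hw) (hg0 _ hw)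
    · rw [hf.coeff_eq_zero hα, zero_mul]
  rw [(hf.mul hg).alt_eq, map_smul, smul_eq_mul] at key
  exact nonneg_of_mul_nonneg_right key (by positivity)

/-- Strictly decreasing exponent vectors are partitions shifted by the staircase. -/
theorem exists_eq_add_stair {γ : Fin n → ℕ} (hγ : StrictAnti γ) :
    ∃ α : Fin n → ℕ, Antitone α ∧ γ = α + stair n := by
  have hge : ∀ (m : ℕ) (i : Fin n), stair n i = m → m ≤ γ i := by
    intro m
    induction m with
    | zero => exact fun _ _ => Nat.zero_le _
    | succ m ih =>
      intro i hi
      simp only [stair] at hi ih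
      have h1 := ih ⟨i + 1, by omega⟩ (by simp; omega)
      have h2 := @hγ i ⟨i + 1, by omega⟩ (by simp [Fin.lt_def])
      omega
  refine ⟨fun i => γ i - stair n i, antitone_of_succ fun k hk => ?_, ?_⟩
  · have := @hγ ⟨k, by omega⟩ ⟨k + 1, hk⟩ (by simp [Fin.lt_def])
    simp only [stair]
    omega
  · ext i
    have := hge _ i rfl
    simp only [Pi.add_apply]
    omega

/-- The row lengths of a Young diagram, as an exponent vector. -/
def rowVec (n : ℕ) (μ : YoungDiagram) : Fin n → ℕ := fun i => μ.rowLen i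

theorem rowVec_antitone (μ : YoungDiagram) : Antitone (rowVec n μ) :=
  fun _ _ hij => μ.rowLen_anti _ _ hij

theorem rowLen_eq_zero {μ : YoungDiagram} {i : ℕ} (h : μ.colLen 0 ≤ i) : μ.rowLen i = 0 := by
  by_contra hne
  have : (i, 0) ∈ μ := YoungDiagram.mem_iff_lt_rowLen.2 (Nat.pos_of_ne_zero hne)
  exact absurd (YoungDiagram.mem_iff_lt_colLen.1 this) (not_lt.2 h)

theorem eq_of_rowVec_eq {μ ν : YoungDiagram} (hμ : μ.colLen 0 ≤ n) (hν : ν.colLen 0 ≤ n)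
    (h : rowVec n μ = rowVec n ν) : μ = ν := by
  have hrow : ∀ i, μ.rowLen i = ν.rowLen i := fun i => by
    rcases lt_or_ge i n with hi | hi
    · exact congrFun h ⟨i, hi⟩
    · rw [rowLen_eq_zero (hμ.trans hi), rowLen_eq_zero (hν.trans hi)]
  ext ⟨i, j⟩
  simp only [YoungDiagram.mem_cells, YoungDiagram.mem_iff_lt_rowLen, hrow]

theorem exists_rowVec_eq {α : Fin n → ℕ} (hα : Antitone α) :
    ∃ μ : YoungDiagram, μ.colLen 0 ≤ n ∧ rowVec n μ = α := by
  classical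
  let μ : YoungDiagram :=
    { cells := {c ∈ range n ×ˢ range (∑ i, α i) | ∃ h : c.1 < n, c.2 < α ⟨c.1, h⟩}
      isLowerSet := by
        rintro ⟨i, j⟩ ⟨i', j'⟩ hle h
        simp only [Prod.mk_le_mk] at hle
        simp only [coe_filter, Set.mem_ofPred_eq, mem_product, mem_range] at h ⊢
        obtain ⟨⟨h1, h2⟩, h3, h4⟩ := h
        have := @hα ⟨i', by omega⟩ ⟨i, by omega⟩ hle.1
        exact ⟨⟨by omega, by omega⟩, by omega, by omega⟩ }
  have hmem : ∀ i j, (i, j) ∈ μ ↔ ∃ h : i < n, j < α ⟨i, h⟩ := by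
    intro i j
    rw [← YoungDiagram.mem_cells]
    simp only [μ, mem_filter, mem_product, mem_range]
    constructor
    · exact fun h => h.2
    · rintro ⟨h, h'⟩
      exact ⟨⟨h, h'.trans_le (single_le_sum (f := α) (fun _ _ => Nat.zero_le _) (mem_univ _))⟩,
        h, h'⟩
  refine ⟨μ, ?_, ?_⟩
  · by_contra! h
    have := (hmem n 0).1 (YoungDiagram.mem_iff_lt_colLen.2 h)
    exact lt_irrefl _ this.1
  · ext i
    refine le_antisymm (not_lt.1 fun h => ?_) (not_lt.1 fun h => ?_)
    · have := (hmem i (α i)).1 (YoungDiagram.mem_iff_lt_rowLen.2 h)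
      exact lt_irrefl _ this.2
    · have := YoungDiagram.mem_iff_lt_rowLen.1 ((hmem i (rowVec n μ i)).2 ⟨i.2, h⟩)
      exact lt_irrefl _ this

theorem res_schur_isSymm (μ : YoungDiagram) : IsSymm (res n (schur μ)) := by
  rw [res_schur]
  exact columnSum_isSymm _ _

theorem vand_mul_res_schur {μ : YoungDiagram} (hμ : μ.colLen 0 ≤ n) :
    vand X * res n (schur μ) = alt (mon (rowVec n μ + stair n)) := by
  rw [res_schur, ← alt_stair_eq_vand, alt_stair_mul_columnSum
    (fun i j hij => μ.colLen_anti i j hij)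
    (fun j _ => (μ.colLen_anti 0 j (Nat.zero_le j)).trans hμ)]
  congr 3
  ext i
  have : {j ∈ range (μ.rowLen 0) | (i : ℕ) < μ.colLen j} = range (μ.rowLen i) := by
    ext j
    simp only [mem_filter, mem_range, ← YoungDiagram.mem_iff_lt_colLen,
      ← YoungDiagram.mem_iff_lt_rowLen]
    exact ⟨fun h => h.2, fun h => ⟨μ.up_left_mem (Nat.zero_le _) le_rfl h, h⟩⟩
  rw [this, card_range, rowVec]

theorem res_schur_eq_zero {μ : YoungDiagram} (hμ : n < μ.colLen 0) : res n (schur μ) = 0 := by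
  rw [res_schur, columnSum_eq_sum_chains]
  refine sum_eq_zero fun f hf => ?_
  have hpos : 0 < μ.rowLen 0 := YoungDiagram.mem_iff_lt_rowLen.1
    (YoungDiagram.mem_iff_lt_colLen.2 (Nat.zero_lt_of_lt hμ))
  obtain ⟨h1, h2⟩ := (mem_chains.1 hf).1 0 hpos
  have := card_le_card h1
  rw [card_range, h2] at this
  omega

theorem coeff_littlewood_mul_schur_nonneg (μ : YoungDiagram) {β : Fin n → ℕ} (hβ : StrictAnti β) :
    0 ≤ coeff (expo β) (littlewood n * res n (schur μ)) := by
  refine littlewood_isAnti.coeff_mul_nonneg (res_schur_isSymm μ)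
    (fun γ hγ => coeff_littlewood_nonneg hγ) fun γ hγ => ?_
  obtain ⟨α, hα, rfl⟩ := exists_eq_add_stair hγ
  rw [res_schur]
  exact coeff_alt_mon_mul_columnSum_nonneg _ hβ _ hα _

theorem continuous_coeff_mul (β : Fin n → ℕ) (g : MvPowerSeries (Fin n) ℝ) :
    Continuous fun f => coeff (expo β) (g * f) :=
  (WithPiTopology.continuous_coeff ℝ _).comp (continuous_const_mul g)

theorem continuous_killCompl {σ τ : Type*} (e : σ ↪ τ) :
    Continuous (killCompl e : MvPowerSeries τ ℝ → MvPowerSeries σ ℝ) :=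
  continuous_pi fun d => WithPiTopology.continuous_coeff ℝ (Finsupp.embDomain e d)

theorem isSymm_of_hasSum {ι : Type*} {f : ι → MvPowerSeries (Fin n) ℝ} {g : MvPowerSeries (Fin n) ℝ}
    (hf : ∀ i, IsSymm (f i)) (h : HasSum f g) : IsSymm g := by
  intro w
  ext d
  obtain ⟨β, rfl⟩ := Finsupp.equivFunOnFinite.symm.surjective d
  change coeff (expo β) _ = coeff (expo β) _
  have h' := WithPiTopology.hasSum_iff_hasSum_coeff.1 h
  rw [coeff_rename_perm]
  refine (h' _).unique ?_
  convert h' (expo β) using 2 with i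
  rw [← coeff_rename_perm, hf]

/-- The coefficient of a Schur polynomial in a Schur expansion is a coefficient of the product with
the Vandermonde product. -/
theorem coeff_vand_mul_of_hasSum {e : YoungDiagram → ℝ} {g : MvPowerSeries (Fin n) ℝ}
    (h : HasSum (fun μ => e μ • res n (schur μ)) g) {ν : YoungDiagram} (hν : ν.colLen 0 ≤ n) :
    coeff (expo (rowVec n ν + stair n)) (vand X * g) = e ν := by
  let Φ : MvPowerSeries (Fin n) ℝ →+ ℝ :=
    (coeff (expo (rowVec n ν + stair n))).toAddMonoidHom.comp (AddMonoidHom.mulLeft (vand X))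
  have h1 := h.map Φ (continuous_coeff_mul _ _)
  refine h1.unique ?_
  have h2 : e ν = Φ (e ν • res n (schur ν)) := by
    change e ν = coeff _ (vand X * (e ν • res n (schur ν)))
    rw [mul_smul_comm, vand_mul_res_schur hν, map_smul,
      coeff_alt_mon (add_stair_strictAnti (rowVec_antitone ν))
        (add_stair_strictAnti (rowVec_antitone ν)), if_pos rfl, smul_eq_mul, mul_one]
  rw [h2]
  refine hasSum_single ν fun μ hμ => ?_
  change coeff _ (vand X * (e μ • res n (schur μ))) = 0
  rcases le_or_gt (μ.colLen 0) n with hle | hlt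
  · rw [mul_smul_comm, vand_mul_res_schur hle, map_smul,
      coeff_alt_mon (add_stair_strictAnti (rowVec_antitone μ))
        (add_stair_strictAnti (rowVec_antitone ν)), if_neg, smul_zero]
    intro h3
    exact hμ (eq_of_rowVec_eq hle hν (add_right_cancel h3).symm)
  · rw [res_schur_eq_zero hlt, smul_zero, mul_zero, map_zero]

theorem degree_content {μ : YoungDiagram} (T : SemistandardYoungTableau μ) :
    (content T).degree = μ.card := by
  rw [content, map_sum]
  simp [YoungDiagram.card]

theorem card_eq_of_coeff_schur_ne_zero {μ : YoungDiagram} {d : ℕ →₀ ℕ}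
    (h : coeff d (schur μ) ≠ 0) : μ.card = d.degree := by
  change ((Nat.card {T : SemistandardYoungTableau μ // content T = d} : ℕ) : ℝ) ≠ 0 at h
  have h1 : Nat.card {T : SemistandardYoungTableau μ // content T = d} ≠ 0 := by
    exact_mod_cast h
  obtain ⟨⟨⟨T, rfl⟩⟩, _⟩ := Nat.card_ne_zero.1 h1
  exact (degree_content T).symm

theorem colLen_zero_le_card (μ : YoungDiagram) : μ.colLen 0 ≤ μ.card := by
  rw [YoungDiagram.colLen_eq_card]
  exact card_le_card (filter_subset _ _)

theorem rowLen_zero_le_card (μ : YoungDiagram) : μ.rowLen 0 ≤ μ.card := by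
  rw [YoungDiagram.rowLen_eq_card]
  exact card_le_card (filter_subset _ _)

theorem finite_card_eq (N : ℕ) : {μ : YoungDiagram | μ.card = N}.Finite := by
  refine Set.Finite.of_finite_image (f := YoungDiagram.cells)
    (((range N ×ˢ range N).powerset.finite_toSet).subset ?_) ?_
  · rintro _ ⟨μ, hμ, rfl⟩
    simp only [Set.mem_ofPred_eq] at hμ
    simp only [coe_powerset, Set.mem_preimage, Set.mem_powerset_iff, coe_subset]
    rintro ⟨i, j⟩ h
    rw [YoungDiagram.mem_cells] at h
    have h1 := YoungDiagram.mem_iff_lt_rowLen.1 h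
    have h2 := YoungDiagram.mem_iff_lt_colLen.1 h
    have h3 := μ.rowLen_anti 0 i (Nat.zero_le i)
    have h4 := μ.colLen_anti 0 j (Nat.zero_le j)
    have h5 := rowLen_zero_le_card μ
    have h6 := colLen_zero_le_card μ
    simp only [mem_product, mem_range]
    omega
  · exact fun μ _ ν _ h => YoungDiagram.ext h

theorem coeff_res (β : Fin n → ℕ) (f : MvPowerSeries ℕ ℝ) :
    coeff (expo β) (res n f) = coeff (Finsupp.embDomain Fin.valEmbedding (expo β)) f := rfl

/-- Every symmetric power series in `n` variables has a Schur expansion. -/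
theorem IsSymm.hasSum_schur {g : MvPowerSeries (Fin n) ℝ} (hg : IsSymm g) :
    HasSum (fun μ : YoungDiagram =>
      (coeff (expo (rowVec n μ + stair n)) (vand X * g)) • res n (schur μ)) g := by
  set e : YoungDiagram → ℝ := fun μ => coeff (expo (rowVec n μ + stair n)) (vand X * g)
  have hs : Summable fun μ => e μ • res n (schur μ) := by
    refine WithPiTopology.summable_iff_summable_coeff.2 fun d => ?_
    refine summable_of_hasFiniteSupport ?_
    refine (finite_card_eq (Finsupp.embDomain Fin.valEmbedding d).degree).subset fun μ hμ => ?_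
    rw [Function.mem_support, map_smul, smul_eq_mul] at hμ
    exact card_eq_of_coeff_schur_ne_zero (right_ne_zero_of_mul hμ)
  obtain ⟨S, hS⟩ := hs
  have hsymm : IsSymm S := isSymm_of_hasSum (fun μ w => by
    rw [map_smul, res_schur_isSymm]) hS
  have : vand X * S = vand X * g := by
    refine (vand_isAnti.mul hsymm).ext (vand_isAnti.mul hg) fun β hβ => ?_
    obtain ⟨α, hα, rfl⟩ := exists_eq_add_stair hβ
    obtain ⟨ν, hν, rfl⟩ := exists_rowVec_eq hα
    exact coeff_vand_mul_of_hasSum hS hν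
  rwa [mul_left_cancel₀ vand_ne_zero this] at hS

theorem killCompl_castLE_res {m : ℕ} (h : n ≤ m) (f : MvPowerSeries ℕ ℝ) :
    killCompl (Fin.castLEEmb h) (res m f) = res n f := by
  ext d
  rw [coeff_killCompl, res, coeff_killCompl, res, coeff_killCompl]
  congr 1
  rw [Finsupp.embDomain_eq_mapDomain, Finsupp.embDomain_eq_mapDomain,
    Finsupp.embDomain_eq_mapDomain, ← Finsupp.mapDomain_comp]
  rfl

/-- The coefficient of a Schur function does not depend on the number of variables. -/
theorem coeff_vand_mul_res_eq {m : ℕ} (h : n ≤ m) {f : MvPowerSeries ℕ ℝ}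
    (hf : IsSymm (res m f)) {μ : YoungDiagram} (hμ : μ.colLen 0 ≤ n) :
    coeff (expo (rowVec n μ + stair n)) (vand X * res n f) =
      coeff (expo (rowVec m μ + stair m)) (vand X * res m f) := by
  have h1 := hf.hasSum_schur.map (killCompl (R := ℝ) (Fin.castLEEmb h)) (continuous_killCompl _)
  rw [killCompl_castLE_res] at h1
  refine coeff_vand_mul_of_hasSum (e := fun μ =>
    coeff (expo (rowVec m μ + stair m)) (vand X * res m f)) ?_ hμ
  convert h1 using 2 with ν
  simp [killCompl_castLE_res]

theorem exists_embDomain_eq (d : ℕ →₀ ℕ) :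
    ∃ (m : ℕ) (β : Fin m → ℕ), d.degree ≤ m ∧
      Finsupp.embDomain Fin.valEmbedding (expo β) = d := by
  refine ⟨d.degree + d.support.sup id + 1, fun i => d i, by omega, ?_⟩
  ext k
  rcases lt_or_ge k (d.degree + d.support.sup id + 1) with hk | hk
  · exact embDomain_val_apply _ ⟨k, hk⟩
  · rw [embDomain_val_of_le _ hk]
    by_contra hne
    have := le_sup (f := id) (Finsupp.mem_support_iff.2 (Ne.symm hne))
    simp only [id] at this
    omega

/-- A formal series all of whose restrictions to finitely many variables are symmetric is
Schur-positive if the products of these restrictions with the Vandermonde products have nonnegative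
coefficients at strictly decreasing exponents. -/
theorem isSchurPositive_of_coeff_nonneg {f : MvPowerSeries ℕ ℝ} (hf : ∀ n, IsSymm (res n f))
    (h : ∀ (n : ℕ) (β : Fin n → ℕ), StrictAnti β → 0 ≤ coeff (expo β) (vand X * res n f)) :
    IsSchurPositive f := by
  refine ⟨fun μ => coeff (expo (rowVec μ.card μ + stair μ.card)) (vand X * res μ.card f),
    fun μ => h _ _ (add_stair_strictAnti (rowVec_antitone μ)), ?_⟩
  refine WithPiTopology.hasSum_iff_hasSum_coeff.2 fun d => ?_
  obtain ⟨m, β, hm, rfl⟩ := exists_embDomain_eq d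
  have h1 := WithPiTopology.hasSum_iff_hasSum_coeff.1 (hf m).hasSum_schur (expo β)
  rw [coeff_res] at h1
  convert h1 using 2 with μ
  rw [map_smul, map_smul, coeff_res, smul_eq_mul, smul_eq_mul]
  by_cases h0 : coeff (Finsupp.embDomain Fin.valEmbedding (expo β)) (schur μ) = 0
  · rw [h0, mul_zero, mul_zero]
  · congr 1
    exact coeff_vand_mul_res_eq ((card_eq_of_coeff_schur_ne_zero h0).trans_le hm) (hf m)
      (colLen_zero_le_card μ)

/-! ### The infinite product over pairs -/

/-- In each degree `d`, only the pairs of variables occurring in `d` matter. -/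
theorem multipliable_pairProd :
    Multipliable fun q : {q : ℕ × ℕ // q.1 < q.2} =>
      (1 - X q.1.1 * X q.1.2 : MvPowerSeries ℕ ℝ) := by
  classical
  simp only [sub_eq_add_neg]
  refine multipliable_one_add_of_summable_prod ?_
  refine WithPiTopology.summable_iff_summable_coeff.2 fun d => ?_
  refine summable_of_hasFiniteSupport ?_
  have hfin : {q : {q : ℕ × ℕ // q.1 < q.2} | q.1 ∈ d.support ×ˢ d.support}.Finite :=
    Set.Finite.preimage Subtype.val_injective.injOn (d.support ×ˢ d.support).finite_toSet
  refine (hfin.toFinset.powerset.finite_toSet).subset fun s hs => ?_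
  simp only [coe_powerset, Set.mem_preimage, Set.mem_powerset_iff, coe_subset]
  intro q hq
  rw [Set.Finite.mem_toFinset, Set.mem_ofPred_eq, mem_product, Finsupp.mem_support_iff,
    Finsupp.mem_support_iff]
  have hz : ∀ (i : ℕ) (g : MvPowerSeries ℕ ℝ), d i = 0 → coeff d (X i * g) = 0 := by
    intro i g hi
    rw [X, coeff_monomial_mul, if_neg]
    intro hle
    have := hle i
    simp [hi] at this
  rw [Function.mem_support, ← mul_prod_erase s _ hq] at hs
  constructor
  · intro h0
    refine hs ?_
    rw [neg_mul, mul_assoc, map_neg, hz _ _ h0, neg_zero]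
  · intro h0
    refine hs ?_
    rw [neg_mul, mul_comm (X q.1.1), mul_assoc, map_neg, hz _ _ h0, neg_zero]

theorem res_X (i : ℕ) : res n (X i) = var n i := by
  rw [res, var]
  split_ifs with h
  · exact killCompl_X (e := Fin.valEmbedding) (⟨i, h⟩ : Fin n)
  · exact killCompl_X_eq_zero (by simpa using h)

theorem res_pairProd : res n pairProd = pairDen X := by
  classical
  rw [pairProd, multipliable_pairProd.map_tprod (res n) (continuous_killCompl _)]
  let ι : {p : Fin n × Fin n // p.1 < p.2} ↪ {q : ℕ × ℕ // q.1 < q.2} :=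
    ⟨fun p => ⟨(p.1.1, p.1.2), p.2⟩, fun p p' h => by
      simp only [Subtype.mk.injEq, Prod.mk.injEq, Fin.val_inj] at h
      exact Subtype.ext (Prod.ext h.1 h.2)⟩
  rw [tprod_eq_prod (s := univ.map ι), prod_map]
  · have h1 : ∀ p : {p : Fin n × Fin n // p.1 < p.2},
        res n (1 - X (ι p).1.1 * X (ι p).1.2) = 1 - X p.1.1 * X p.1.2 := fun p => by
      change res n (1 - X (p.1.1 : ℕ) * X (p.1.2 : ℕ)) = _
      simp [res_X, var]
    simp only [h1]
    rw [← prod_subtype {p : Fin n × Fin n | p.1 < p.2} (by simp) fun p => 1 - X p.1 * X p.2,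
      prod_filter, Fintype.prod_prod_type, pairDen]
    refine prod_congr rfl fun a _ => ?_
    rw [← prod_filter]
    congr 1
    ext b
    simp
  · intro q hq
    have : n ≤ q.1.2 := by
      by_contra! hlt
      refine hq (mem_map.2 ⟨⟨(⟨q.1.1, q.2.trans hlt⟩, ⟨q.1.2, hlt⟩), q.2⟩, mem_univ _, rfl⟩)
    rw [map_sub, map_one, map_mul, res_X, res_X, var, var, dif_neg (not_lt.2 this), mul_zero,
      sub_zero]

theorem constantCoeff_pairProd : constantCoeff pairProd = 1 := by
  rw [pairProd, multipliable_pairProd.map_tprod constantCoeff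
    (WithPiTopology.continuous_constantCoeff ℝ)]
  simp

theorem res_inv_pairProd : res n pairProd⁻¹ = (pairDen X)⁻¹ := by
  have h := congrArg (res n) (MvPowerSeries.mul_inv_cancel pairProd
    (by rw [constantCoeff_pairProd]; exact one_ne_zero))
  rw [map_mul, map_one, res_pairProd] at h
  have h2 := pairDen_mul_inv (n := n)
  linear_combination (pairDen X)⁻¹ * h - res n pairProd⁻¹ * h2

/-- Division by `∏_{i<j} (1 - x_i x_j)` preserves Schur-positivity. -/
theorem IsSchurPositive.mul_inv_pairProd {f : MvPowerSeries ℕ ℝ} (hf : IsSchurPositive f) :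
    IsSchurPositive (f * pairProd⁻¹) := by
  obtain ⟨c, hc, hsum⟩ := hf
  have hres : ∀ n, HasSum (fun μ => c μ • res n (schur μ)) (res n f) := fun n => by
    have := hsum.map (res n) (continuous_killCompl _)
    simpa [Function.comp_def] using this
  refine isSchurPositive_of_coeff_nonneg (fun n => ?_) fun n β hβ => ?_
  · rw [map_mul, res_inv_pairProd]
    exact (isSymm_of_hasSum (fun μ w => by rw [map_smul, res_schur_isSymm]) (hres n)).mul
      inv_pairDen_isSymm
  · have h1 : vand X * res n (f * pairProd⁻¹) = littlewood n * res n f := by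
      rw [map_mul, res_inv_pairProd, littlewood]
      ring
    rw [h1]
    let Φ : MvPowerSeries (Fin n) ℝ →+ ℝ :=
      (coeff (expo β)).toAddMonoidHom.comp (AddMonoidHom.mulLeft (littlewood n))
    refine ((hres n).map Φ (continuous_coeff_mul _ _)).nonneg fun μ => ?_
    change 0 ≤ coeff (expo β) (littlewood n * (c μ • res n (schur μ)))
    rw [mul_smul_comm, map_smul]
    exact mul_nonneg (hc μ) (coeff_littlewood_mul_schur_nonneg μ hβ)

end SchurPos

end

theorem mainTheorem5 (p : PowerSeries ℝ) (hp : PowerSeries.constantCoeff p = 1)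
    (h : SchurPos.IsSchurPositive (SchurPos.varProd p)) :
    SchurPos.IsKappaPositive p :=
  SchurPos.IsSchurPositive.mul_inv_pairProd h
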